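/- **Conventions.** All fields $K$ are finitely generated extension fields of $\mathbb C$. A finite extension $B/A$ of fields containing $\mathbb C$ has essential dimension at most $m$ if it is obtained by base change from an extension $L/F$ with $F\subseteq A$, $F\subseteq L\subseteq B$, $[L:F]=[B:A]$, $B=AL$ and $\operatorname{tr.deg}_{\mathbb C}F\le m$. The resolvent degree $\mathrm{RD}(K'/K)$ is the least $m$ for which there is a tower of finite extensions $K=E_0\subseteq E_1\subseteq\cdots\subseteq E_n$ such that $K'$ embeds into $E_n$ over $K$ and every $E_{j+1}/E_j$ has essential dimension at most $m$ (and $\infty$ if there is none). For $n\ge 1$, $\mathrm{RD}(n)$ is the resolvent degree of $K_n[z]/(z^n+a_1z^{n-1}+\cdots+a_n)$ over $K_n=\mathbb C(a_1,\dots,a_n)$. A *type* $(d;\ell_d,\dots,\ell_1)$ consists of integers $d\ge 1$, $\ell_d\ge 1$ and $\ell_{d-1},\dots,\ell_1\ge 0$. An intersection of hypersurfaces of this type in $\mathbb P^r_K$ is the common zero locus of a system of homogeneous polynomials in $K[x_0,\dots,x_r]$ with exactly $\ell_j$ members of degree $j$ for $1\le j\le d$. *Minimal dimension bound.* $r(d;\ell_d,\dots,\ell_1)$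 is the least $r'\in\mathbb Z_{\ge1}\cup\{\infty\}$ such that for every integer $r\ge r'$, every $K$ and every intersection of hypersurfaces $V\subseteq\mathbb P^r_K$ of type $(d;\ell_d,\dots,\ell_1)$, there is an extension $K'/K$ with $\mathrm{RD}(K'/K)\le\mathrm{RD}(d)$ and $V(K')\neq\emptyset$. *Geometric dimension bound.* $g(d;\ell_d,\dots,\ell_1)$ is the value of the following recursion ($\infty$ if the recursion does not terminate). - $g(1;\ell_1)=\ell_1$. - $g(d;0,\ell_{d-1},\dots,\ell_1)=g(d-1;\ell_{d-1},\dots,\ell_1)$ for $d\ge2$ (a zero column in top degree is omitted). - $g(2;1,\ell_1)=1+\ell_1$, and $g(2;\ell_2,\ell_1)=g(2;\ell_2-1,\ell_2+\ell_1)$ for $\ell_2\ge2$. - For $d\ge3$, $$g(d;1,\ell_{d-1},\dots,\ell_1)=g\Bigl(d-1;\ \ell_{d-1},\ \ell_{d-1}+\ell_{d-2},\ \dots,\ \sum_{i=2}^{d-1}\ell_i,\ \Bigl(\sum_{i=1}^{d-1}\ell_i\Bigr)+1\Bigr).$$ - For $d\ge3$ and $\ell_d\ge2$, $$g(d;\ell_d,\dots,\ell_1)=g\Bigl(d;\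 \ell_d-1,\ (\ell_d+\ell_{d-1})-1,\ \dots,\ \Bigl(\sum_{i=2}^{d}\ell_i\Bigr)-1,\ \sum_{i=1}^{d}\ell_i\Bigr).$$ **Proposition (Minimal vs. Geometric Dimension Bound).** For every type $(d;\ell_d,\dots,\ell_1)$ of an intersection of hypersurfaces, $$r(d;\ell_d,\dots,\ell_1)\ \le\ g(d;\ell_d,\dots,\ell_1)\ <\ \infty .$$ -/

import Mathlib

open Polynomial

universe u v

noncomputable section

/-! ### Resolvent degree over `ℂ` -/

/-- The essential dimension (over `ℂ`) of a finite extension of fields `B / A`, where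
`ℂ ⊆ A ⊆ B` are given as subfields of a field `E`. It is the least transcendence degree over `ℂ`
of a field `F ⊆ A` from which `B / A` can be obtained by base change, i.e. for which there is
a field `L` with `F ⊆ L ⊆ B`, `[L : F] = [B : A]` and `B = A L`. -/
def essentialDimension {E : Type u} [Field E] [Algebra ℂ E] (A B : IntermediateField ℂ E) : ℕ∞ :=
  sInf {e : ℕ∞ | ∃ F L : IntermediateField ℂ E, F ≤ A ∧ F ≤ L ∧ A ⊔ L = B ∧
    IntermediateField.relfinrank F L = IntermediateField.relfinrank A B ∧
    e = Cardinal.toENat (Algebra.trdeg ℂ F)}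

/-- `IsResolventTower K E n c` : the subfields `c 0 ⊆ c 1 ⊆ ⋯ ⊆ c n` form a tower of field
extensions from `K` to `E`, that is, `c 0` is the image of `K` and `c n` is all of `E`.
(If `E / K` is finite, so is every step of the tower.) -/
structure IsResolventTower (K : Type u) [Field K] [Algebra ℂ K] (E : Type u) [Field E]
    [Algebra ℂ E] [Algebra K E] [IsScalarTower ℂ K E] (n : ℕ) (c : ℕ → IntermediateField ℂ E) :
    Prop where
  bot : c 0 = (IsScalarTower.toAlgHom ℂ K E).fieldRange
  le_succ : ∀ j < n, c j ≤ c (j + 1)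
  top : c n = ⊤

/-- The resolvent degree of `K' / K`: the least `m` such that there is a tower of finite
extensions `K = E₀ ⊆ E₁ ⊆ ⋯ ⊆ Eₙ` in which every step has essential dimension at most `m` and
such that `K'` embeds into `Eₙ` over `K`. It is `⊤` if there is no such tower.
`K'` is a field in all uses; its inverses are not needed for the definition. -/
def resolventDegree (K : Type u) [Field K] [Algebra ℂ K] (K' : Type v) [CommRing K']
    [Algebra K K'] : ℕ∞ :=
  sInf {m : ℕ∞ | ∃ (E : Type u) (_ : Field E) (_ : Algebra ℂ E) (_ : Algebra K E)
    (_ : IsScalarTower ℂ K E) (n : ℕ) (c : ℕ → IntermediateField ℂ E),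
    FiniteDimensional K E ∧ IsResolventTower K E n c ∧
    (∀ j < n, essentialDimension (c j) (c (j + 1)) ≤ m) ∧
    ∃ φ : K' →ₐ[K] E, Function.Injective φ}

/-- The field `ℂ(a₁, …, aₙ)` of rational functions; the variable `a_{i+1}` is `X i`, `i : Fin n`. -/
abbrev GeneralField (n : ℕ) : Type := FractionRing (MvPolynomial (Fin n) ℂ)

/-- The general polynomial `zⁿ + a₁ zⁿ⁻¹ + ⋯ + aₙ` of degree `n`. -/
def generalPolynomial (n : ℕ) : (GeneralField n)[X] :=
  X ^ n + ∑ i : Fin n,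
    C (algebraMap (MvPolynomial (Fin n) ℂ) (GeneralField n) (MvPolynomial.X i)) *
      X ^ (n - 1 - (i : ℕ))

/-- `RD(n)`, the resolvent degree of the general polynomial of degree `n ≥ 1`. -/
def generalRD (n : ℕ) : ℕ∞ :=
  resolventDegree (GeneralField n) (AdjoinRoot (generalPolynomial n))

/-! ### Intersections of hypersurfaces and the minimal dimension bound -/

/-- A system of forms in `K[x₀, …, x_r]` of type `(d; ℓ_d, …, ℓ_1)`: for each degree
`j ∈ [1, d]` there are `ℓ j` forms of degree `j`. Forms may be repeated or vanish identically
(as happens for polars). -/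
structure HypersurfaceIntersection (K : Type u) [Field K] (r d : ℕ) (ℓ : ℕ → ℕ) where
  form : (j : Set.Icc 1 d) → Fin (ℓ j) → MvPolynomial (Fin (r + 1)) K
  isHomogeneous : ∀ (j : Set.Icc 1 d) (i : Fin (ℓ j)), (form j i).IsHomogeneous j

/-- The `K'`-rational points in `ℙ^r` of an intersection of hypersurfaces over `K`. -/
def HypersurfaceIntersection.points {K : Type u} [Field K] {r d : ℕ} {ℓ : ℕ → ℕ}
    (V : HypersurfaceIntersection K r d ℓ) (K' : Type v) [Field K'] [Algebra K K'] :
    Set (Projectivization K' (Fin (r + 1) → K')) :=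
  {P | ∀ (j : Set.Icc 1 d) (i : Fin (ℓ j)), MvPolynomial.aeval P.rep (V.form j i) = 0}

/-- The minimal dimension bound `r(d; ℓ_d, …, ℓ_1)`: the least `r' ∈ {1, 2, …} ∪ {∞}` such that,
whenever `r ≥ r'`, every intersection of hypersurfaces of type `(d; ℓ_d, …, ℓ_1)` in `ℙ^r` over
a finitely generated extension field `K` of `ℂ` has a point over some extension `K' / K` with
`RD(K' / K) ≤ RD(d)`. -/
def minimalDimensionBound (d : ℕ) (ℓ : ℕ → ℕ) : ℕ∞ :=
  sInf {r' : ℕ∞ | 1 ≤ r' ∧ ∀ r : ℕ, r' ≤ r →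
    ∀ (K : Type u) [Field K] [Algebra ℂ K], (⊤ : IntermediateField ℂ K).FG →
    ∀ V : HypersurfaceIntersection K r d ℓ,
    ∃ (K' : Type u) (_ : Field K') (_ : Algebra K K'),
      resolventDegree K K' ≤ generalRD d ∧ (V.points K').Nonempty}

/-! ### The geometric dimension bound -/

/-- `HasGeometricValue d ℓ n`: the recursion that defines `g(d; ℓ_d, …, ℓ_1)` terminates with the
value `n`. Only the entries `ℓ 1, …, ℓ d` matter. At each `(d, ℓ)` at most one rule applies. -/
inductive HasGeometricValue : ℕ → (ℕ → ℕ) → ℕ → Prop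
  /-- `g(1; ℓ_1) = ℓ_1` -/
  | linear (ℓ : ℕ → ℕ) : HasGeometricValue 1 ℓ (ℓ 1)
  /-- A zero column in the top degree is omitted:
  `g(d; 0, ℓ_{d-1}, …, ℓ_1) = g(d-1; ℓ_{d-1}, …, ℓ_1)` for `d ≥ 2`. -/
  | omit_zero (d : ℕ) (ℓ : ℕ → ℕ) (n : ℕ) (hd : 2 ≤ d) (h : ℓ d = 0)
      (hn : HasGeometricValue (d - 1) ℓ n) : HasGeometricValue d ℓ n
  /-- `g(2; 1, ℓ_1) = 1 + ℓ_1` -/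
  | one_quadric (ℓ : ℕ → ℕ) (h : ℓ 2 = 1) : HasGeometricValue 2 ℓ (1 + ℓ 1)
  /-- `g(2; ℓ_2, ℓ_1) = g(2; ℓ_2 - 1, ℓ_2 + ℓ_1)` for `ℓ_2 ≥ 2` -/
  | quadrics (ℓ : ℕ → ℕ) (n : ℕ) (h : 2 ≤ ℓ 2)
      (hn : HasGeometricValue 2 (fun j => if j = 1 then ℓ 2 + ℓ 1 else ℓ 2 - 1) n) :
      HasGeometricValue 2 ℓ n
  /-- For `d ≥ 3`, `g(d; 1, ℓ_{d-1}, …, ℓ_1)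
  = g(d-1; ℓ_{d-1}, ℓ_{d-1} + ℓ_{d-2}, …, ∑_{i=2}^{d-1} ℓ_i, (∑_{i=1}^{d-1} ℓ_i) + 1)`. -/
  | one_top (d : ℕ) (ℓ : ℕ → ℕ) (n : ℕ) (hd : 3 ≤ d) (h : ℓ d = 1)
      (hn : HasGeometricValue (d - 1)
        (fun j => if j = 1 then (∑ i ∈ Finset.Icc 1 (d - 1), ℓ i) + 1
          else ∑ i ∈ Finset.Icc j (d - 1), ℓ i) n) :
      HasGeometricValue d ℓ n
  /-- For `d ≥ 3` and `ℓ_d ≥ 2`, `g(d; ℓ_d, …, ℓ_1)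
  = g(d; ℓ_d - 1, ℓ_d + ℓ_{d-1} - 1, …, (∑_{i=2}^d ℓ_i) - 1, ∑_{i=1}^d ℓ_i)`. -/
  | several_top (d : ℕ) (ℓ : ℕ → ℕ) (n : ℕ) (hd : 3 ≤ d) (h : 2 ≤ ℓ d)
      (hn : HasGeometricValue d
        (fun j => if j = 1 then ∑ i ∈ Finset.Icc 1 d, ℓ i
          else (∑ i ∈ Finset.Icc j d, ℓ i) - 1) n) :
      HasGeometricValue d ℓ n

/-- The geometric dimension bound `g(d; ℓ_d, …, ℓ_1)`: the value of the recursion, which is `∞`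
if the recursion does not terminate. -/
def geometricDimensionBound (d : ℕ) (ℓ : ℕ → ℕ) : ℕ∞ :=
  sInf {g : ℕ∞ | ∃ n : ℕ, HasGeometricValue d ℓ n ∧ g = n}

end

-- Put `m = RD(d)`. If `m` is infinite, the algebraic closure of `K` is an admissible `K'`.
-- Otherwise let `B`, inside an algebraic closure of `K`, be the union of all fields obtained from
-- `K` by repeatedly adjoining elements that are algebraic over at most `m` elements already
-- constructed (`rdClosure`). Two independent facts about `B` give the bound.
--
-- Arithmetic (`hasRootsUpTo_of_rdClosed`): polynomials of degree between 1 and `d` over `B` have a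
-- root in `B`. Take a tower that computes `RD(d)` for the general polynomial. For coefficients in
-- `B` off a proper hypersurface, sending the general coefficients and the general root to given
-- ones extends to any prescribed finite part of the top field `E`. The elements of `E` that
-- specialize into `B` form a field containing the bottom of the tower, and this field climbs the
-- tower because `B` is closed under algebraic dependence on `m` elements. So the root is in `B`. A
-- special polynomial is made general by a Tschirnhaus transformation with complex coefficients.
--
-- Geometry (`HasGeometricValue.hasCommonZeros`): over such a `B`, set one form of top degree aside.
-- Find a zero `P` of the others, then a zero `Q` of all their polars at `P` on a hyperplane missing
-- `P`. The line `PQ` lies in the zero locus of the others, and the form set aside restricts to it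
-- as a polynomial of degree at most `d`, which has a zero over `B`. Counting polars by degree gives
-- exactly the recursion for `g`.
--
-- The coordinates of the zero are finitely many elements of `B`, so they lie in a single field that
-- is finite over `K` and has a tower with steps of essential dimension at most `m`.

universe w

/-! ### Restriction of forms to lines, and polars -/

/-- The restriction of `f` to the parametrized line `T ↦ P + T Q`. -/
noncomputable def lineRestriction {R : Type*} [CommRing R] {σ : Type*} (f : MvPolynomial σ R)
    (P Q : σ → R) : R[X] :=
  MvPolynomial.aeval (fun i => C (P i) + C (Q i) * X) f

/-- The polars of `f` at the point `P`: the coefficients of `f (P + T x)` as a polynomial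
in `T`. -/
noncomputable def polar {R : Type*} [CommRing R] {σ : Type*} (f : MvPolynomial σ R)
    (P : σ → R) (k : ℕ) : MvPolynomial σ R :=
  (MvPolynomial.aeval (R := R)
    (fun i => (C (MvPolynomial.C (P i)) + C (MvPolynomial.X i) * X : (MvPolynomial σ R)[X]))
    f).coeff k

section lines

variable {R : Type*} [CommRing R] {σ : Type*} (f : MvPolynomial σ R) (P Q : σ → R)

theorem eval_lineRestriction (t : R) :
    (lineRestriction f P Q).eval t = MvPolynomial.eval (P + t • Q) f := by
  have h : (Polynomial.aeval t).comp
      (MvPolynomial.aeval (R := R) (fun i => (C (P i) + C (Q i) * X : R[X]))) =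
      MvPolynomial.aeval (P + t • Q) := by
    ext i
    simp only [AlgHom.comp_apply, MvPolynomial.aeval_X, Polynomial.coe_aeval_eq_eval, eval_add,
      eval_mul, eval_C, eval_X, Pi.add_apply, Pi.smul_apply, smul_eq_mul]
    ring
  have := DFunLike.congr_fun h f
  simpa [lineRestriction, Polynomial.coe_aeval_eq_eval, MvPolynomial.aeval_eq_eval] using this

theorem coeff_lineRestriction (k : ℕ) :
    (lineRestriction f P Q).coeff k = MvPolynomial.eval Q (polar f P k) := by
  have h : (Polynomial.mapAlgHom (MvPolynomial.aeval (R := R) Q)).comp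
      (MvPolynomial.aeval (R := R)
        (fun i => (C (MvPolynomial.C (P i)) + C (MvPolynomial.X i) * X : (MvPolynomial σ R)[X]))) =
      MvPolynomial.aeval (fun i => (C (P i) + C (Q i) * X : R[X])) := by
    ext i
    simp
  have := DFunLike.congr_fun h f
  rw [lineRestriction, ← this, polar]
  simp

theorem isHomogeneous_polar (k : ℕ) : (polar f P k).IsHomogeneous k := by
  -- Polynomials in `T` whose `T ^ k` coefficient is homogeneous of degree `k` form a subalgebra,
  -- and it contains each `P i + x i T`.
  let S : Subalgebra R (MvPolynomial σ R)[X] :=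
    { carrier := {p | ∀ k, (p.coeff k).IsHomogeneous k}
      mul_mem' := by
        intro p q hp hq k
        rw [Polynomial.coeff_mul]
        refine MvPolynomial.IsHomogeneous.sum _ _ _ fun x hx => ?_
        rw [← Finset.HasAntidiagonal.mem_antidiagonal.1 hx]
        exact (hp _).mul (hq _)
      add_mem' := by
        intro p q hp hq k
        rw [Polynomial.coeff_add]
        exact (hp k).add (hq k)
      algebraMap_mem' := by
        intro c k
        rw [Polynomial.algebraMap_apply, Polynomial.coeff_C]
        split_ifs with h
        · rw [h]; exact MvPolynomial.isHomogeneous_C _ _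
        · exact MvPolynomial.isHomogeneous_zero _ _ _ }
  have h : MvPolynomial.aeval (R := R)
      (fun i => (C (MvPolynomial.C (P i)) + C (MvPolynomial.X i) * X : (MvPolynomial σ R)[X]))
      f ∈ S := by
    induction f using MvPolynomial.induction_on with
    | C c => simpa using S.algebraMap_mem c
    | add p q hp hq => rw [map_add]; exact S.add_mem hp hq
    | mul_X p i hp =>
      rw [map_mul, MvPolynomial.aeval_X]
      refine S.mul_mem hp (S.add_mem ?_ ?_)
      · exact S.algebraMap_mem (P i)
      · intro k
        rw [Polynomial.coeff_C_mul, Polynomial.coeff_X]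
        split_ifs with h
        · rw [← h, mul_one]; exact MvPolynomial.isHomogeneous_X _ _
        · rw [mul_zero]; exact MvPolynomial.isHomogeneous_zero _ _ _
  exact h k

theorem natDegree_coeff_prod_linear (s : Finset σ) (m : σ → ℕ) :
    (∏ i ∈ s, (C (P i) + C (Q i) * X : R[X]) ^ m i).natDegree ≤ ∑ i ∈ s, m i ∧
      (∏ i ∈ s, (C (P i) + C (Q i) * X : R[X]) ^ m i).coeff (∑ i ∈ s, m i) =
        ∏ i ∈ s, Q i ^ m i := by
  classical
  have h1 : ∀ i, (C (P i) + C (Q i) * X : R[X]).natDegree ≤ 1 := fun i => by compute_degree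
  have h2 : ∀ i, ((C (P i) + C (Q i) * X : R[X]) ^ m i).natDegree ≤ m i := fun i => by
    simpa using natDegree_pow_le_of_le (m i) (h1 i)
  induction s using Finset.induction_on with
  | empty => simp
  | insert a s ha ih =>
    rw [Finset.prod_insert ha, Finset.sum_insert ha, Finset.prod_insert ha]
    refine ⟨natDegree_mul_le_of_le (h2 a) ih.1, ?_⟩
    rw [coeff_mul_add_eq_of_natDegree_le (h2 a) ih.1, ih.2]
    congr 1
    have := coeff_pow_of_natDegree_le (m := m a) (h1 a)
    simpa using this

variable {f} [Fintype σ]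

/-- The coefficient of `T ^ j` is the value at the point at infinity `Q` of the line. Hence a drop
in degree means that `Q` itself is a zero of `f`. -/
theorem natDegree_coeff_lineRestriction {j : ℕ} (hf : f.IsHomogeneous j) :
    (lineRestriction f P Q).natDegree ≤ j ∧
      (lineRestriction f P Q).coeff j = MvPolynomial.eval Q f := by
  have hm : ∀ m ∈ f.support, ∑ i, m i = j := fun m hm => by
    have := hf (MvPolynomial.mem_support_iff.1 hm)
    rw [← this, Finsupp.weight_apply, Finsupp.sum_fintype] <;> simp
  rw [lineRestriction, MvPolynomial.aeval_def, MvPolynomial.eval₂_eq']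
  constructor
  · refine natDegree_sum_le_of_forall_le _ _ fun m hm' => ?_
    refine (natDegree_C_mul_le _ _).trans ?_
    rw [← hm m hm']
    exact (natDegree_coeff_prod_linear P Q Finset.univ m).1
  · rw [MvPolynomial.eval_eq', finsetSum_coeff]
    refine Finset.sum_congr rfl fun m hm' => ?_
    rw [← hm m hm']
    have := (natDegree_coeff_prod_linear P Q Finset.univ m).2
    rw [← this]
    exact coeff_C_mul _

theorem lineRestriction_eq_zero {j : ℕ} (hf : f.IsHomogeneous j) (hP : MvPolynomial.eval P f = 0)
    (hQ : ∀ k, 1 ≤ k → k ≤ j → MvPolynomial.eval Q (polar f P k) = 0) :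
    lineRestriction f P Q = 0 := by
  ext k
  rw [coeff_zero]
  rcases Nat.eq_zero_or_pos k with rfl | hk
  · rw [coeff_zero_eq_eval_zero, eval_lineRestriction]; simpa using hP
  by_cases hkj : k ≤ j
  · rw [coeff_lineRestriction]; exact hQ k hk hkj
  · exact coeff_eq_zero_of_natDegree_lt
      ((natDegree_coeff_lineRestriction P Q hf).1.trans_lt (not_le.1 hkj))

end lines

/-! ### Common zeros of systems of forms by the polar method -/

/-- Every polynomial over `B` of degree between `1` and `d` has a root in `B`. -/
def HasRootsUpTo (B : Type u) [Field B] (d : ℕ) : Prop :=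
  ∀ p : B[X], 1 ≤ p.natDegree → p.natDegree ≤ d → ∃ x, p.IsRoot x

/-- Every system of forms in `r + 1` variables over `B` of degrees between `1` and `d`, at most
`ℓ j` of them of degree `j`, has a nontrivial common zero. -/
def HasCommonZeros (B : Type u) [Field B] (r d : ℕ) (ℓ : ℕ → ℕ) : Prop :=
  ∀ (ι : Type) [Fintype ι] (deg : ι → ℕ) (f : ι → MvPolynomial (Fin (r + 1)) B),
    (∀ i, 1 ≤ deg i ∧ deg i ≤ d) → (∀ i, (f i).IsHomogeneous (deg i)) →
    (∀ j, 1 ≤ j → j ≤ d → Nat.card {i // deg i = j} ≤ ℓ j) →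
    ∃ x, x ≠ 0 ∧ ∀ i, MvPolynomial.eval x (f i) = 0

section systems

variable {B : Type u} [Field B] {r d : ℕ} {ℓ ℓ' : ℕ → ℕ}

theorem HasCommonZeros.mono (h : HasCommonZeros B r d ℓ)
    (hle : ∀ j, 1 ≤ j → j ≤ d → ℓ' j ≤ ℓ j) : HasCommonZeros B r d ℓ' :=
  fun ι _ deg f hd hf hc => h ι deg f hd hf fun j h1 h2 => (hc j h1 h2).trans (hle j h1 h2)

theorem HasRootsUpTo.mono {d' : ℕ} (h : HasRootsUpTo B d) (hd : d' ≤ d) : HasRootsUpTo B d' :=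
  fun p h1 h2 => h p h1 (h2.trans hd)

theorem eval_add_smul_of_linear {f : MvPolynomial (Fin (r + 1)) B} (hf : f.IsHomogeneous 1)
    (P Q : Fin (r + 1) → B) (t : B) :
    MvPolynomial.eval (P + t • Q) f = MvPolynomial.eval P f + t * MvPolynomial.eval Q f := by
  obtain ⟨h1, h2⟩ := natDegree_coeff_lineRestriction P Q hf
  have h0 : (lineRestriction f P Q).coeff 0 = MvPolynomial.eval P f := by
    rw [coeff_zero_eq_eval_zero, eval_lineRestriction, zero_smul, add_zero]
  rw [← eval_lineRestriction, eq_X_add_C_of_natDegree_le_one h1, h0, h2]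
  simp only [eval_add, eval_mul, eval_C, eval_X]
  ring

theorem hasCommonZeros_linear (hr : ℓ 1 ≤ r) : HasCommonZeros B r 1 ℓ := by
  intro ι _ deg f hd hf hc
  have hdeg : ∀ i, deg i = 1 := fun i => le_antisymm (hd i).2 (hd i).1
  have hcard : Fintype.card ι < r + 1 := by
    have h := hc 1 le_rfl le_rfl
    rw [Nat.card_congr (Equiv.subtypeUnivEquiv hdeg), Nat.card_eq_fintype_card] at h
    omega
  have hadd : ∀ i (P Q : Fin (r + 1) → B) (t : B), MvPolynomial.eval (P + t • Q) (f i) =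
      MvPolynomial.eval P (f i) + t * MvPolynomial.eval Q (f i) :=
    fun i => eval_add_smul_of_linear (by have := hf i; rwa [hdeg i] at this)
  let φ : (Fin (r + 1) → B) →ₗ[B] (ι → B) :=
    { toFun := fun x i => MvPolynomial.eval x (f i)
      map_add' := fun x y => by ext i; simpa using hadd i x y 1
      map_smul' := fun t x => by
        ext i
        have h1 := hadd i 0 0 1
        have h2 := hadd i 0 x t
        simp only [smul_zero, add_zero, one_mul, left_eq_add] at h1
        rw [h1, zero_add, zero_add] at h2
        exact h2 }
  obtain ⟨x, hx, hx0⟩ := (Submodule.ne_bot_iff _).1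
    (LinearMap.ker_ne_bot_of_finrank_lt (f := φ) (by simpa using hcard))
  exact ⟨x, hx0, fun i => congrFun (LinearMap.mem_ker.1 hx) i⟩

/-- A hyperplane avoiding the point `P`. -/
theorem exists_linear_form_ne_zero {P : Fin (r + 1) → B} (hP : P ≠ 0) :
    ∃ h : MvPolynomial (Fin (r + 1)) B, h.IsHomogeneous 1 ∧ MvPolynomial.eval P h ≠ 0 := by
  obtain ⟨k, hk⟩ := Function.ne_iff.1 hP
  exact ⟨MvPolynomial.X k, MvPolynomial.isHomogeneous_X _ _, by simpa using hk⟩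

/-- Each form of degree at least `j` has exactly one polar of degree `j`, and forms of lower degree
have none. The index `none` stands for the auxiliary hyperplane, which accounts for the extra 1 in
degree 1. -/
theorem card_polars_le {ι : Type} [Fintype ι] (deg : ι → ℕ) (hd : ∀ i, deg i ≤ d) {j : ℕ}
    (hc : ∀ e, j ≤ e → e ≤ d → Nat.card {i // deg i = e} ≤ ℓ e) :
    Nat.card {x : Option (Σ i, Fin (deg i)) // x.elim 1 (fun y => (y.2 : ℕ) + 1) = j} ≤
      ∑ e ∈ Finset.Icc j d, ℓ e + if j = 1 then 1 else 0 := by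
  classical
  have h0 : ∀ (α : Type) [Fintype α] (p : α → Prop) [DecidablePred p],
      Nat.card {x // p x} = ∑ x, if p x then 1 else 0 := fun α _ p _ => by
    rw [Nat.card_eq_fintype_card, Fintype.card_subtype, Finset.card_filter]
  rw [h0, Fintype.sum_option, Fintype.sum_sigma, add_comm]
  simp only [Option.elim]
  refine add_le_add ?_ (le_of_eq (if_congr eq_comm rfl rfl))
  calc ∑ i, ∑ k : Fin (deg i), (if (k : ℕ) + 1 = j then 1 else 0)
      ≤ ∑ i, ∑ e ∈ Finset.Icc j d, (if deg i = e then 1 else 0) := by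
        refine Finset.sum_le_sum fun i _ => ?_
        by_cases hji : j ≤ deg i
        · rw [Finset.sum_ite_eq, if_pos (Finset.mem_Icc.2 ⟨hji, hd i⟩), ← Finset.card_filter,
            Finset.card_le_one]
          intro a ha b hb
          simp only [Finset.mem_filter, Finset.mem_univ, true_and] at ha hb
          exact Fin.ext (by omega)
        · rw [Finset.sum_eq_zero]
          · exact Nat.zero_le _
          · intro k _
            rw [if_neg]
            have := k.2
            omega
    _ = ∑ e ∈ Finset.Icc j d, ∑ i, (if deg i = e then 1 else 0) := Finset.sum_comm
    _ ≤ ∑ e ∈ Finset.Icc j d, ℓ e := by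
        refine Finset.sum_le_sum fun e he => ?_
        rw [← h0]
        exact hc e (Finset.mem_Icc.1 he).1 (Finset.mem_Icc.1 he).2

/-- If systems that are large enough to contain the polars have zeros, then the zero locus of
the forms `f i` contains a line. -/
theorem HasCommonZeros.exists_line (h : HasCommonZeros B r d ℓ') (h1 : 1 ≤ d)
    (hle : ∀ j, 1 ≤ j → j ≤ d → ∑ e ∈ Finset.Icc j d, ℓ e + (if j = 1 then 1 else 0) ≤ ℓ' j)
    {ι : Type} [Fintype ι] (deg : ι → ℕ) (f : ι → MvPolynomial (Fin (r + 1)) B)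
    (hd : ∀ i, 1 ≤ deg i ∧ deg i ≤ d) (hf : ∀ i, (f i).IsHomogeneous (deg i))
    (hc : ∀ j, 1 ≤ j → j ≤ d → Nat.card {i // deg i = j} ≤ ℓ j) :
    ∃ P Q : Fin (r + 1) → B, Q ≠ 0 ∧ (∀ t : B, P + t • Q ≠ 0) ∧
      ∀ i, lineRestriction (f i) P Q = 0 := by
  obtain ⟨P, hP, hPf⟩ := h.mono (ℓ' := ℓ) (fun j h1 h2 => (Finset.single_le_sum
    (fun _ _ => Nat.zero_le _) (Finset.mem_Icc.2 ⟨le_rfl, h2⟩)).trans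
    ((Nat.le_add_right _ _).trans (hle j h1 h2))) ι deg f hd hf hc
  -- Requiring `g` to vanish at `Q` but not at `P` makes the two points distinct, so that no `P + t
  -- • Q` is zero.
  obtain ⟨g, hg, hgP⟩ := exists_linear_form_ne_zero hP
  obtain ⟨Q, hQ, hQf⟩ := h (Option (Σ i, Fin (deg i)))
    (fun x => x.elim 1 (fun y => (y.2 : ℕ) + 1))
    (fun x => x.elim g (fun y => polar (f y.1) P (y.2 + 1)))
    (by
      rintro (_ | ⟨i, k⟩)
      · exact ⟨le_rfl, h1⟩
      · exact ⟨Nat.le_add_left _ _, k.2.trans_le (hd i).2⟩)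
    (by
      rintro (_ | ⟨i, k⟩)
      · exact hg
      · exact isHomogeneous_polar _ _ _)
    (fun j h1 h2 => (card_polars_le deg (fun i => (hd i).2)
      fun e he1 he2 => hc e (h1.trans he1) he2).trans (hle j h1 h2))
  refine ⟨P, Q, hQ, fun t ht => hgP ?_, fun i => ?_⟩
  · have h1 := eval_add_smul_of_linear hg P Q t
    have h2 : MvPolynomial.eval Q g = 0 := hQf none
    have h3 := eval_add_smul_of_linear hg 0 0 1
    simp only [smul_zero, add_zero, one_mul, left_eq_add] at h3
    rw [ht, h2, h3] at h1
    simpa using h1.symm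
  · refine lineRestriction_eq_zero P Q (hf i) (hPf i) fun k hk1 hk2 => ?_
    obtain ⟨k, rfl⟩ := Nat.exists_eq_add_of_le' hk1
    exact hQf (some ⟨i, ⟨k, hk2⟩⟩)

/-- On a line contained in the zero locus of the `f i`, a form of degree at most `d` has a zero. -/
theorem HasRootsUpTo.exists_zero_on_line (hB : HasRootsUpTo B d) (hd : 1 ≤ d)
    {P Q : Fin (r + 1) → B} (hQ : Q ≠ 0) (hPQ : ∀ t : B, P + t • Q ≠ 0)
    {F : MvPolynomial (Fin (r + 1)) B} (hF : F.IsHomogeneous d) :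
    ∃ x, x ≠ 0 ∧ MvPolynomial.eval x F = 0 ∧
      ∀ (j : ℕ) (f : MvPolynomial (Fin (r + 1)) B), f.IsHomogeneous j →
        lineRestriction f P Q = 0 → MvPolynomial.eval x f = 0 := by
  obtain ⟨h1, h2⟩ := natDegree_coeff_lineRestriction P Q hF
  by_cases h : ∃ t, (lineRestriction F P Q).IsRoot t
  · obtain ⟨t, ht⟩ := h
    refine ⟨P + t • Q, hPQ t, ?_, fun j f _ hf => ?_⟩
    · rwa [← eval_lineRestriction]
    · rw [← eval_lineRestriction, hf, eval_zero]
  -- Without a root the restriction is constant, so its coefficient in degree `d ≥ 1` vanishes and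
  -- the zero sits at infinity.
  · have h3 : (lineRestriction F P Q).natDegree = 0 := by
      by_contra h0
      exact h (hB _ (Nat.one_le_iff_ne_zero.2 h0) h1)
    refine ⟨Q, hQ, ?_, fun j f hf h0 => ?_⟩
    · rw [← h2]
      exact coeff_eq_zero_of_natDegree_lt (by omega)
    · rw [← (natDegree_coeff_lineRestriction P Q hf).2, h0, coeff_zero]

/-- One step of the recursion. After one form of degree `d` is set aside, the remaining ones have
degree at most `e`: this is `d - 1` if the form was the only one of degree `d`. Systems of type `ℓ'`
have room for their polars and a hyperplane, so the remaining forms vanish on a line, where the form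
set aside has a zero. -/
theorem HasCommonZeros.of_line {e : ℕ} (h : HasCommonZeros B r e ℓ') (hB : HasRootsUpTo B d)
    (hd : 1 ≤ d) (he : 1 ≤ e) (hed : e = d ∨ (e + 1 = d ∧ ℓ d ≤ 1))
    (hle : ∀ j, 1 ≤ j → j ≤ e → ∑ i ∈ Finset.Icc j e, (if i = d then ℓ d - 1 else ℓ i) +
      (if j = 1 then 1 else 0) ≤ ℓ' j) : HasCommonZeros B r d ℓ := by
  classical
  intro ι _ deg f hdeg hf hc
  by_cases h0 : ∃ i₀, deg i₀ = d
  · obtain ⟨i₀, hi₀⟩ := h0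
    obtain ⟨P, Q, hQ, hPQ, hl⟩ := h.exists_line he
      (ℓ := fun i => if i = d then ℓ d - 1 else ℓ i) hle
      (ι := {i // i ≠ i₀}) (fun i => deg i) (fun i => f i)
      (fun i => ⟨(hdeg i).1, by
        rcases hed with rfl | ⟨hed, h1⟩
        · exact (hdeg i).2
        · have h2 := (hc d hd le_rfl).trans h1
          rw [Finite.card_le_one_iff_subsingleton] at h2
          have h3 : deg i ≠ d := fun h3 =>
            i.2 (congrArg Subtype.val (Subsingleton.elim (⟨i, h3⟩ : {i // deg i = d}) ⟨i₀, hi₀⟩))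
          have := (hdeg i).2
          omega⟩) (fun i => hf i)
      (fun j hj1 hj2 => by
        have hjd : j ≤ d := by omega
        have hinj : Function.Injective
            (fun x : {i : {i // i ≠ i₀} // deg i = j} => (⟨x.1, x.2⟩ : {i // deg i = j})) := by
          intro x y hxy
          simpa [Subtype.ext_iff] using hxy
        split_ifs with hj
        · subst hj
          have h1 : Nat.card {i : {i // i ≠ i₀} // deg i = j} < Nat.card {i // deg i = j} := by
            rw [Nat.card_eq_fintype_card, Nat.card_eq_fintype_card]
            refine Fintype.card_lt_of_injective_of_notMem _ hinj (b := ⟨i₀, hi₀⟩) ?_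
            rintro ⟨x, hx⟩
            exact x.1.2 (congrArg Subtype.val hx)
          have := hc j hj1 hjd
          omega
        · exact (Nat.card_le_card_of_injective _ hinj).trans (hc j hj1 hjd))
    obtain ⟨x, hx, hxF, hxf⟩ := hB.exists_zero_on_line hd hQ hPQ (hi₀ ▸ hf i₀)
    refine ⟨x, hx, fun i => ?_⟩
    by_cases hi : i = i₀
    · rw [hi]; exact hxF
    · exact hxf _ _ (hf i) (hl ⟨i, hi⟩)
  -- `ℓ` only bounds the number of forms, so there may be none of degree `d`. Then the line lies in
  -- the whole zero locus and `Q` serves.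
  · push Not at h0
    obtain ⟨P, Q, hQ, hPQ, hl⟩ := h.exists_line he
      (ℓ := fun i => if i = d then ℓ d - 1 else ℓ i) hle
      deg f (fun i => ⟨(hdeg i).1, by
        have := (hdeg i).2
        have := h0 i
        omega⟩) hf
      (fun j hj1 hj2 => by
        split_ifs with hj
        · subst hj
          have : IsEmpty {i // deg i = j} := ⟨fun x => h0 x.1 x.2⟩
          simp
        · exact hc j hj1 (by omega))
    exact ⟨Q, hQ, fun i => by
      rw [← (natDegree_coeff_lineRestriction P Q (hf i)).2, hl, coeff_zero]⟩

end systems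

/-! ### The recursion for the geometric dimension bound -/

section recursion

theorem HasGeometricValue.le_value {d n : ℕ} {ℓ : ℕ → ℕ} (h : HasGeometricValue d ℓ n) :
    ℓ 1 ≤ n := by
  induction h with
  | linear ℓ => exact le_rfl
  | omit_zero d ℓ n hd h hn ih => exact ih
  | one_quadric ℓ h => exact Nat.le_add_left _ _
  | quadrics ℓ n h hn ih => simp only [if_true] at ih; omega
  | one_top d ℓ n hd h hn ih =>
    have := Finset.single_le_sum (f := ℓ) (fun _ _ => Nat.zero_le _)
      (Finset.mem_Icc.2 ⟨le_rfl, show 1 ≤ d - 1 by omega⟩)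
    simp only [if_true] at ih
    omega
  | several_top d ℓ n hd h hn ih =>
    have := Finset.single_le_sum (f := ℓ) (fun _ _ => Nat.zero_le _)
      (Finset.mem_Icc.2 ⟨le_rfl, show 1 ≤ d by omega⟩)
    simp only [if_true] at ih
    omega

/-- Needed because the minimal dimension bound only admits candidates that are at least 1. -/
theorem HasGeometricValue.one_le {d n : ℕ} {ℓ : ℕ → ℕ} (h : HasGeometricValue d ℓ n)
    (hℓ : 1 ≤ ℓ d) : 1 ≤ n := by
  cases h with
  | linear => exact hℓ
  | omit_zero _ _ _ hd h hn => omega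
  | one_quadric _ h => omega
  | quadrics _ _ h hn =>
    have := hn.le_value
    simp only [if_true] at this
    omega
  | one_top _ _ _ hd h hn =>
    have := hn.le_value
    simp only [if_true] at this
    omega
  | several_top _ _ _ hd h hn =>
    have := hn.le_value
    have := Finset.single_le_sum (f := ℓ) (fun _ _ => Nat.zero_le _)
      (Finset.mem_Icc.2 ⟨show 1 ≤ d by omega, le_rfl⟩)
    simp only [if_true] at *
    omega

/-- The recursion terminates. -/
theorem exists_hasGeometricValue (d : ℕ) (hd : 1 ≤ d) (ℓ : ℕ → ℕ) :
    ∃ n, HasGeometricValue d ℓ n := by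
  induction d, hd using Nat.le_induction generalizing ℓ with
  | base => exact ⟨_, .linear ℓ⟩
  | succ d hd ih =>
    -- The induction is lexicographic in the degree and the top multiplicity: each rule either
    -- lowers the degree or lowers the top multiplicity by one, however much the lower columns grow.
    induction hm : ℓ (d + 1) using Nat.strong_induction_on generalizing ℓ with
    | _ m ihm =>
      rcases Nat.lt_or_ge m 1 with h | h
      · obtain ⟨n, hn⟩ := ih ℓ
        exact ⟨n, .omit_zero _ _ _ (by omega) (by omega) hn⟩
      rcases Nat.lt_or_ge m 2 with h1 | h1
      · rcases Nat.lt_or_ge d 2 with h2 | h2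
        · obtain rfl : d = 1 := by omega
          exact ⟨_, .one_quadric ℓ (by have : ℓ 2 = m := hm; omega)⟩
        · obtain ⟨n, hn⟩ := ih _
          exact ⟨n, .one_top _ _ _ (by omega) (by omega) hn⟩
      · rcases Nat.lt_or_ge d 2 with h2 | h2
        · obtain rfl : d = 1 := by omega
          obtain ⟨n, hn⟩ := ihm (m - 1) (by omega)
            (fun j => if j = 1 then ℓ 2 + ℓ 1 else ℓ 2 - 1) (by simp [← hm])
          exact ⟨n, .quadrics _ _ (by simpa [hm] using h1) hn⟩
        · obtain ⟨n, hn⟩ := ihm (m - 1) (by omega)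
            (fun j => if j = 1 then ∑ i ∈ Finset.Icc 1 (d + 1), ℓ i
              else (∑ i ∈ Finset.Icc j (d + 1), ℓ i) - 1)
            (by rw [if_neg (by omega), Finset.Icc_self, Finset.sum_singleton, hm])
          exact ⟨n, .several_top _ _ _ (by omega) (by omega) hn⟩

theorem sum_Icc_pred_top {d j : ℕ} (ℓ : ℕ → ℕ) (hj : j ≤ d) (hℓ : 1 ≤ ℓ d) :
    ∑ i ∈ Finset.Icc j d, (if i = d then ℓ d - 1 else ℓ i) = (∑ i ∈ Finset.Icc j d, ℓ i) - 1 := by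
  have hmem : d ∈ Finset.Icc j d := Finset.mem_Icc.2 ⟨hj, le_rfl⟩
  rw [← Finset.add_sum_erase _ _ hmem, ← Finset.add_sum_erase _ ℓ hmem, if_pos rfl,
    Finset.sum_congr (g := ℓ) rfl fun i hi => if_neg (Finset.ne_of_mem_erase hi)]
  exact (Nat.sub_add_comm hℓ).symm

/-- If polynomials of degree at most `d` over `B` have roots in `B`, then forms of type
`(d; ℓ_d, …, ℓ_1)` in projective space of dimension at least `g(d; ℓ_d, …, ℓ_1)` have a
common zero. -/
theorem HasGeometricValue.hasCommonZeros {B : Type u} [Field B] {d n r : ℕ} {ℓ : ℕ → ℕ}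
    (h : HasGeometricValue d ℓ n) (hr : n ≤ r) (hB : HasRootsUpTo B d) :
    HasCommonZeros B r d ℓ := by
  induction h with
  | linear ℓ => exact hasCommonZeros_linear hr
  | omit_zero d ℓ n hd h hn ih =>
    intro ι _ deg f hdeg hf hc
    have h0 : IsEmpty {i // deg i = d} := by
      have := hc d (by omega) le_rfl
      rw [h, Nat.le_zero, Finite.card_eq_zero_iff] at this
      exact this
    refine ih hr (hB.mono (by omega)) ι deg f (fun i => ⟨(hdeg i).1, ?_⟩) hf
      (fun j h1 h2 => hc j h1 (by omega))
    have h1 : deg i ≠ d := fun h1 => h0.elim ⟨i, h1⟩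
    have := (hdeg i).2
    omega
  | one_quadric ℓ h =>
    have h1 : HasCommonZeros B r 1 (fun _ => 1 + ℓ 1) := hasCommonZeros_linear hr
    refine h1.of_line hB (by omega) le_rfl (Or.inr ⟨rfl, h.le⟩) fun j hj1 hj2 => ?_
    obtain rfl : j = 1 := by omega
    simp [add_comm]
  | quadrics ℓ n h hn ih =>
    refine (ih hr hB).of_line hB (by omega) (by omega) (Or.inl rfl) fun j hj1 hj2 => ?_
    rw [sum_Icc_pred_top ℓ hj2 (by omega)]
    obtain rfl | rfl : j = 1 ∨ j = 2 := by omega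
    · simp [Finset.sum_Icc_succ_top]; omega
    · simp
  | one_top d ℓ n hd h hn ih =>
    refine (ih hr (hB.mono (by omega))).of_line hB (by omega) (by omega)
      (Or.inr ⟨by omega, h.le⟩) fun j hj1 hj2 => ?_
    have h0 : ∑ i ∈ Finset.Icc j (d - 1), (if i = d then ℓ d - 1 else ℓ i) =
        ∑ i ∈ Finset.Icc j (d - 1), ℓ i :=
      Finset.sum_congr rfl fun i hi => if_neg (by have := (Finset.mem_Icc.1 hi).2; omega)
    rw [h0]
    by_cases hj : j = 1
    · subst hj; simp
    · simp [hj]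
  | several_top d ℓ n hd h hn ih =>
    refine (ih hr hB).of_line hB (by omega) (by omega) (Or.inl rfl) fun j hj1 hj2 => ?_
    rw [sum_Icc_pred_top ℓ hj2 (by omega)]
    by_cases hj : j = 1
    · subst hj
      have := Finset.single_le_sum (f := ℓ) (fun _ _ => Nat.zero_le _)
        (Finset.mem_Icc.2 ⟨hj2, le_rfl⟩)
      simp
      omega
    · simp [hj]

end recursion

/-! ### Algebraic dependence on finitely many elements -/

section algebraicOverFinset

variable {k E Ω : Type*} [Field k] [Field E] [Field Ω] [Algebra k E] [Algebra k Ω]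

theorem isAlgebraic_adjoin_of_image (φ : E →ₐ[k] Ω) {s : Set E} {x : E}
    (h : IsAlgebraic (Algebra.adjoin k (φ '' s)) (φ x)) : IsAlgebraic (Algebra.adjoin k s) x := by
  have hmap : (Algebra.adjoin k s).map φ = Algebra.adjoin k (φ '' s) := AlgHom.map_adjoin φ s
  let f : Algebra.adjoin k s →ₐ[k] Algebra.adjoin k (φ '' s) :=
    (φ.comp (Algebra.adjoin k s).val).codRestrict _ fun a => by
      rw [← hmap]; exact ⟨a, a.2, rfl⟩
  refine h.of_ringHom_of_comp_eq f φ ?_ φ.injective rfl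
  rintro ⟨b, hb⟩
  rw [← hmap] at hb
  obtain ⟨a, ha, rfl⟩ := hb
  exact ⟨⟨a, ha⟩, rfl⟩

/-- Algebraicity is preserved by specializations at which the leading coefficient of an
equation does not vanish. -/
theorem isAlgebraic_adjoin_image_of_leadingCoeff {S : Subalgebra k E} (ψ : S →ₐ[k] Ω) {s : Set E}
    (hs : s ⊆ S) (p : (Algebra.adjoin k s)[X]) {x : S} (hx : aeval (x : E) p = 0)
    (h0 : (p.leadingCoeff : E) ≠ 0) (hinv : (p.leadingCoeff : E)⁻¹ ∈ S) :
    IsAlgebraic (Algebra.adjoin k (ψ '' {y | (y : E) ∈ s})) (ψ x) := by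
  have hle : Algebra.adjoin k s ≤ S := Algebra.adjoin_le hs
  let s' : Set S := {y | (y : E) ∈ s}
  have hs' : S.val '' s' = s := by
    ext y
    exact ⟨fun ⟨z, hz, h⟩ => h ▸ hz, fun hy => ⟨⟨y, hs hy⟩, hy, rfl⟩⟩
  have hmem : ∀ a : Algebra.adjoin k s,
      ψ (Subalgebra.inclusion hle a) ∈ Algebra.adjoin k (ψ '' s') := by
    rintro ⟨a, ha⟩
    have ha' := ha
    rw [← hs', ← AlgHom.map_adjoin] at ha'
    obtain ⟨b, hb, rfl⟩ := ha'
    rw [← AlgHom.map_adjoin]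
    exact ⟨b, hb, rfl⟩
  let f : Algebra.adjoin k s →ₐ[k] Algebra.adjoin k (ψ '' s') :=
    (ψ.comp (Subalgebra.inclusion hle)).codRestrict _ hmem
  refine ⟨p.map (f : Algebra.adjoin k s →+* _), fun hp0 => ?_, ?_⟩
  -- The leading coefficient is a unit of `S`, so `ψ` cannot kill it and the transported equation
  -- stays nonzero.
  · have h1 : f p.leadingCoeff = 0 := by
      have := congrArg (fun q => q.coeff p.natDegree) hp0
      simpa using this
    have h2 : ψ ⟨p.leadingCoeff, hle p.leadingCoeff.2⟩ = 0 := congrArg Subtype.val h1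
    have h3 : (⟨p.leadingCoeff, hle p.leadingCoeff.2⟩ : S) * ⟨_, hinv⟩ = 1 :=
      Subtype.ext (mul_inv_cancel₀ h0)
    have h4 := congrArg ψ h3
    rw [map_mul, h2, zero_mul, map_one] at h4
    exact zero_ne_one h4
  · have h1 : ((algebraMap (Algebra.adjoin k (ψ '' s')) Ω).comp (f : Algebra.adjoin k s →+* _)) =
        (ψ : S →+* Ω).comp (Subalgebra.inclusion hle : Algebra.adjoin k s →+* S) := rfl
    have h2 : (algebraMap (Algebra.adjoin k s) E) =
        (S.val : S →+* E).comp (Subalgebra.inclusion hle : Algebra.adjoin k s →+* S) := rfl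
    have h3 : eval₂ (Subalgebra.inclusion hle : Algebra.adjoin k s →+* S) x p = 0 := by
      apply Subtype.val_injective
      have := hom_eval₂ p (Subalgebra.inclusion hle : Algebra.adjoin k s →+* S)
        (S.val : S →+* E) x
      rw [← h2] at this
      exact this.trans hx
    rw [aeval_def, eval₂_map, h1]
    have := hom_eval₂ p (Subalgebra.inclusion hle : Algebra.adjoin k s →+* S) (ψ : S →+* Ω) x
    rw [h3, map_zero] at this
    exact this.symm

theorem natDegree_minpoly_le_of_coeff_mem (A : IntermediateField k E) {x : E} {q : E[X]}
    (hq : q.Monic) (hA : ∀ i, q.coeff i ∈ A) (hx : q.eval x = 0) :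
    (minpoly A x).natDegree ≤ q.natDegree := by
  have h : q ∈ lifts (algebraMap A E) := by
    rw [lifts_iff_coeff_lifts]
    exact fun n => ⟨⟨_, hA n⟩, rfl⟩
  obtain ⟨q', rfl⟩ := (mem_lifts _).1 h
  have hq' : q'.Monic := (Function.Injective.monic_map_iff (algebraMap A E).injective).2 hq
  rw [natDegree_map]
  refine natDegree_le_of_dvd (minpoly.dvd A x ?_) hq'.ne_zero
  rwa [← eval_map_algebraMap]

/-- The minimal polynomial over `A` is a monic factor of the one over `F`, and monic factors of a
monic polynomial with integral coefficients have integral coefficients. -/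
theorem coeff_map_minpoly_mem_algebraicClosure {F A : IntermediateField k E} (hFA : F ≤ A) {x : E}
    (hx : IsIntegral F x) (i : ℕ) :
    IsIntegral F (((minpoly A x).map (algebraMap A E)).coeff i) := by
  have hxA : IsIntegral A x := by
    obtain ⟨p, hp, h0⟩ := hx
    refine ⟨p.map (IntermediateField.inclusion hFA : F →+* A), hp.map _, ?_⟩
    rw [eval₂_map]; exact h0
  have hdvd : (minpoly A x).map (algebraMap A E) ∣ (minpoly F x).map (algebraMap F E) := by
    have h1 : minpoly A x ∣ (minpoly F x).map (IntermediateField.inclusion hFA : F →+* A) := by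
      refine minpoly.dvd A x ?_
      rw [← eval_map_algebraMap, map_map]
      have := minpoly.aeval F x
      rwa [← eval_map_algebraMap] at this
    have h2 := Polynomial.map_dvd (algebraMap A E) h1
    rwa [map_map] at h2
  have := integralClosure.mem_lifts_of_monic_of_dvd_map E (minpoly.monic hx)
    ((minpoly.monic hxA).map _) hdvd
  rw [lifts_iff_coeff_lifts] at this
  obtain ⟨y, hy⟩ := this i
  rw [← hy]
  exact y.2

theorem relfinrank_sup_adjoin_simple (A : IntermediateField k E) {x : E} (hx : IsIntegral A x) :
    IntermediateField.relfinrank A (A ⊔ IntermediateField.adjoin k {x}) =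
      (minpoly A x).natDegree := by
  rw [IntermediateField.relfinrank_eq_finrank_of_le le_sup_left,
    ← IntermediateField.adjoin.finrank hx]
  have : IntermediateField.extendScalars (le_sup_left : A ≤ A ⊔ IntermediateField.adjoin k {x}) =
      IntermediateField.adjoin A {x} := by
    apply IntermediateField.restrictScalars_injective k
    rw [IntermediateField.restrictScalars_adjoin_eq_sup]
    rfl
  rw [this]

theorem trdeg_le_card_of_isAlgebraic (F : IntermediateField k E) (Y : Finset E)
    (hF : ∀ a ∈ F, IsAlgebraic (Algebra.adjoin k (Y : Set E)) a) (hY : ∀ y ∈ Y, y ∈ F) :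
    Cardinal.toENat (Algebra.trdeg k F) ≤ Y.card := by
  let s : Set F := {a | (a : E) ∈ Y}
  have hs : F.val '' s = Y := by
    ext a
    constructor
    · rintro ⟨b, hb, rfl⟩; exact hb
    · intro ha; exact ⟨⟨a, hY a ha⟩, ha, rfl⟩
  have : Algebra.IsAlgebraic (Algebra.adjoin k s) F :=
    ⟨fun a => isAlgebraic_adjoin_of_image F.val (by rw [hs]; exact hF a a.2)⟩
  have h1 := Algebra.IsAlgebraic.trdeg_le_cardinalMk k s
  have h2 : Cardinal.mk s = Y.card := by
    rw [← Cardinal.mk_image_eq (f := F.val) F.val.injective, hs]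
    exact Cardinal.mk_coe_finset
  rw [h2] at h1
  simpa using Cardinal.toENat.monotone' h1

end algebraicOverFinset

/-! ### Essential dimension of simple extensions -/

section essentialDimension

variable {E : Type u} [Field E] [Algebra ℂ E]

/-- Over `ℂ(Y)` the degree of `x` may exceed its degree over `A`. The remedy is to descend to `F`,
the algebraic closure of `ℂ(Y)` inside `A`: it is still algebraic over `Y`, and it contains the
coefficients of the minimal polynomial of `x` over `A`. So `x` has the same degree over `F` as over
`A`. -/
theorem essentialDimension_sup_adjoin_simple_le (A : IntermediateField ℂ E) (Y : Finset E)
    (hY : ∀ y ∈ Y, y ∈ A) {x : E} (hx : IsAlgebraic (Algebra.adjoin ℂ (Y : Set E)) x) :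
    essentialDimension A (A ⊔ IntermediateField.adjoin ℂ {x}) ≤ Y.card := by
  let F₀ := IntermediateField.adjoin ℂ (Y : Set E)
  let F : IntermediateField ℂ E := A ⊓ (algebraicClosure F₀ E).restrictScalars ℂ
  have hF₀A : F₀ ≤ A := IntermediateField.adjoin_le_iff.2 hY
  have hF₀F : F₀ ≤ F := le_inf hF₀A fun a ha =>
    (isIntegral_algebraMap (R := F₀) (A := E) (x := ⟨a, ha⟩) :)
  have hxF₀ : IsIntegral F₀ x :=
    isAlgebraic_iff_isIntegral.1 (IntermediateField.isAlgebraic_adjoin_iff.2 hx)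
  have hup : ∀ {D : IntermediateField ℂ E}, F₀ ≤ D → IsIntegral D x := fun {D} hD => by
    obtain ⟨p, hp, h0⟩ := hxF₀
    refine ⟨p.map (IntermediateField.inclusion hD : F₀ →+* D), hp.map _, ?_⟩
    rw [eval₂_map]; exact h0
  refine le_trans (sInf_le ⟨F, F ⊔ IntermediateField.adjoin ℂ {x}, inf_le_left, le_sup_left, ?_, ?_,
    rfl⟩) (trdeg_le_card_of_isAlgebraic F Y ?_ ?_)
  · rw [← sup_assoc, sup_eq_left.2 (inf_le_left : F ≤ A)]
  · rw [relfinrank_sup_adjoin_simple F (hup hF₀F), relfinrank_sup_adjoin_simple A (hup hF₀A)]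
    apply le_antisymm
    · have h1 := (minpoly.monic (hup hF₀A)).map (algebraMap A E)
      have h2 := natDegree_minpoly_le_of_coeff_mem F (x := x) h1
        (fun i => ⟨by rw [coeff_map]; exact ((minpoly A x).coeff i).2,
          coeff_map_minpoly_mem_algebraicClosure hF₀A hxF₀ i⟩)
        (by rw [eval_map_algebraMap]; exact minpoly.aeval A x)
      rwa [natDegree_map] at h2
    · have h1 := (minpoly.monic (hup hF₀F)).map (algebraMap F E)
      have h2 := natDegree_minpoly_le_of_coeff_mem A (x := x) h1
        (fun i => by rw [coeff_map]; exact ((minpoly F x).coeff i).2.1)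
        (by rw [eval_map_algebraMap]; exact minpoly.aeval F x)
      rwa [natDegree_map] at h2
  · intro a ha
    exact IntermediateField.isAlgebraic_adjoin_iff.1 (isAlgebraic_iff_isIntegral.2 ha.2)
  · intro y hy
    exact hF₀F (IntermediateField.subset_adjoin _ _ hy)

theorem essentialDimension_map_le {E' : Type u} [Field E'] [Algebra ℂ E'] (φ : E →ₐ[ℂ] E')
    (A B : IntermediateField ℂ E) :
    essentialDimension (A.map φ) (B.map φ) ≤ essentialDimension A B := by
  refine le_sInf ?_
  rintro e ⟨F, L, hFA, hFL, hAL, hrel, rfl⟩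
  refine sInf_le ⟨F.map φ, L.map φ, IntermediateField.map_mono φ hFA,
    IntermediateField.map_mono φ hFL, ?_, ?_, ?_⟩
  · rw [← IntermediateField.map_sup, hAL]
  · rw [IntermediateField.relfinrank_map_map, IntermediateField.relfinrank_map_map, hrel]
  · rw [(F.equivMap φ).trdeg_eq]

end essentialDimension

/-! ### Towers with steps of bounded essential dimension -/

section towers

variable (m : ℕ∞) (K : Type u) [Field K] [Algebra ℂ K]

/-- `E / K` is the top of a tower of finite extensions of essential dimension at most `m`. -/
def HasResolventTower (E : Type u) [Field E] [Algebra ℂ E] [Algebra K E] [IsScalarTower ℂ K E] :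
    Prop :=
  FiniteDimensional K E ∧ ∃ (n : ℕ) (c : ℕ → IntermediateField ℂ E), IsResolventTower K E n c ∧
    ∀ j < n, essentialDimension (c j) (c (j + 1)) ≤ m

variable {m K}

theorem HasResolventTower.resolventDegree_le {E : Type u} [Field E] [Algebra ℂ E] [Algebra K E]
    [IsScalarTower ℂ K E] (h : HasResolventTower m K E) : resolventDegree K E ≤ m := by
  obtain ⟨hfin, n, c, hc, hed⟩ := h
  exact sInf_le ⟨E, _, _, _, inferInstance, n, c, hfin, hc, hed, AlgHom.id K E,
    Function.injective_id⟩

/-- The tower of `E` is carried into `E'` by `φ`, which does not raise essential dimensions, and one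
simple step is put on top. -/
theorem HasResolventTower.extend {E E' : Type u} [Field E] [Algebra ℂ E] [Algebra K E]
    [IsScalarTower ℂ K E] [Field E'] [Algebra ℂ E'] [Algebra K E'] [IsScalarTower ℂ K E']
    [FiniteDimensional K E'] (h : HasResolventTower m K E) (φ : E →ₐ[K] E') (Y : Finset E')
    (hYm : (Y.card : ℕ∞) ≤ m) (hY : ∀ y ∈ Y, y ∈ (φ.restrictScalars ℂ).fieldRange) {x : E'}
    (hx : IsAlgebraic (Algebra.adjoin ℂ (Y : Set E')) x)
    (htop : (φ.restrictScalars ℂ).fieldRange ⊔ IntermediateField.adjoin ℂ {x} = ⊤) :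
    HasResolventTower m K E' := by
  obtain ⟨_, n, c, ⟨hbot, hle, hctop⟩, hed⟩ := h
  have hn : (c n).map (φ.restrictScalars ℂ) = (φ.restrictScalars ℂ).fieldRange := by
    rw [hctop, AlgHom.fieldRange_eq_map]
  refine ⟨inferInstance, n + 1,
    fun j => if j ≤ n then (c j).map (φ.restrictScalars ℂ) else ⊤, ⟨?_, ?_, ?_⟩, ?_⟩
  · rw [if_pos (Nat.zero_le _), hbot]
    ext a
    simp only [IntermediateField.mem_map, AlgHom.mem_fieldRange]
    constructor
    · rintro ⟨_, ⟨b, rfl⟩, rfl⟩; exact ⟨b, (φ.commutes b).symm⟩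
    · rintro ⟨b, rfl⟩; exact ⟨_, ⟨b, rfl⟩, φ.commutes b⟩
  · intro j hj
    rcases Nat.lt_or_ge j n with h | h
    · rw [if_pos h.le, if_pos (show j + 1 ≤ n from h)]; exact IntermediateField.map_mono _ (hle j h)
    · rw [if_neg (show ¬ j + 1 ≤ n by omega)]; exact le_top
  · rw [if_neg (by omega)]
  · intro j hj
    rcases Nat.lt_or_ge j n with h | h
    · simp only [if_pos h.le, if_pos (show j + 1 ≤ n from h)]
      exact (essentialDimension_map_le _ _ _).trans (hed j h)
    · obtain rfl : j = n := by omega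
      simp only [le_rfl, if_true, if_neg (show ¬ j + 1 ≤ j by omega), hn]
      rw [← htop]
      exact (essentialDimension_sup_adjoin_simple_le _ Y hY hx).trans hYm

end towers

/-! ### Reachable fields and their union -/

/-- The fields obtained from `K` by successively adjoining elements that are algebraic over at
most `m` elements of the field constructed before. -/
inductive IsReachable (m : ℕ∞) (K Ω : Type u) [Field K] [Field Ω] [Algebra ℂ Ω]
    [Algebra K Ω] :
    IntermediateField K Ω → Prop
  | bot : IsReachable m K Ω ⊥
  | step (A : IntermediateField K Ω) (Y : Finset Ω) (x : Ω) (hA : IsReachable m K Ω A)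
      (hY : ∀ y ∈ Y, y ∈ A) (hYm : (Y.card : ℕ∞) ≤ m)
      (hx : IsAlgebraic (Algebra.adjoin ℂ (Y : Set Ω)) x) :
      IsReachable m K Ω (A ⊔ IntermediateField.adjoin K {x})

/-- `B` contains every element that is algebraic over at most `m` elements of `B`. -/
def RDClosed (m : ℕ∞) {Ω : Type u} [Field Ω] [Algebra ℂ Ω] (B : IntermediateField ℂ Ω) : Prop :=
  ∀ Y : Finset Ω, (∀ y ∈ Y, y ∈ B) → (Y.card : ℕ∞) ≤ m →
    ∀ x, IsAlgebraic (Algebra.adjoin ℂ (Y : Set Ω)) x → x ∈ B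

section reachable

variable {m : ℕ∞} {K Ω : Type u} [Field K] [Field Ω] [Algebra ℂ Ω] [Algebra K Ω]

/-- The steps leading to `A'` can be repeated on top of `A`. This makes the family of reachable
fields directed. -/
theorem IsReachable.sup {A A' : IntermediateField K Ω} (h : IsReachable m K Ω A)
    (h' : IsReachable m K Ω A') : IsReachable m K Ω (A ⊔ A') := by
  induction h' with
  | bot => rwa [sup_bot_eq]
  | step A' Y x hA' hY hYm hx ih =>
    rw [← sup_assoc]
    exact .step _ Y x ih (fun y hy => (le_sup_right : A' ≤ A ⊔ A') (hY y hy)) hYm hx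

variable (m K Ω)

/-- The union of all reachable fields. -/
noncomputable def rdClosure : IntermediateField K Ω :=
  ⨆ A : {A : IntermediateField K Ω // IsReachable m K Ω A}, A.1

variable {m K Ω}

theorem exists_isReachable_of_mem_rdClosure {x : Ω} (hx : x ∈ rdClosure m K Ω) :
    ∃ A, IsReachable m K Ω A ∧ x ∈ A := by
  have : Nonempty {A : IntermediateField K Ω // IsReachable m K Ω A} := ⟨⟨⊥, .bot⟩⟩
  have hdir : Directed (· ≤ ·)
      (fun A : {A : IntermediateField K Ω // IsReachable m K Ω A} => A.1) := fun A A' =>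
    ⟨⟨A.1 ⊔ A'.1, A.2.sup A'.2⟩, le_sup_left, le_sup_right⟩
  have h : x ∈ (rdClosure m K Ω : Set Ω) := hx
  rw [rdClosure, IntermediateField.coe_iSup_of_directed hdir, Set.mem_iUnion] at h
  obtain ⟨A, hA⟩ := h
  exact ⟨A.1, A.2, hA⟩

theorem exists_isReachable_of_finset (Y : Finset Ω) (hY : ∀ y ∈ Y, y ∈ rdClosure m K Ω) :
    ∃ A, IsReachable m K Ω A ∧ ∀ y ∈ Y, y ∈ A := by
  classical
  induction Y using Finset.induction_on with
  | empty => exact ⟨⊥, .bot, by simp⟩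
  | insert y Y _ ih =>
    obtain ⟨A, hA, hYA⟩ := ih fun z hz => hY z (Finset.mem_insert_of_mem hz)
    obtain ⟨A', hA', hyA'⟩ :=
      exists_isReachable_of_mem_rdClosure (hY y (Finset.mem_insert_self _ _))
    refine ⟨A ⊔ A', hA.sup hA', fun z hz => ?_⟩
    rcases Finset.mem_insert.1 hz with rfl | hz
    · exact (le_sup_right : A' ≤ A ⊔ A') hyA'
    · exact (le_sup_left : A ≤ A ⊔ A') (hYA z hz)

theorem IsReachable.le_rdClosure {A : IntermediateField K Ω} (h : IsReachable m K Ω A) :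
    A ≤ rdClosure m K Ω :=
  le_iSup (fun A : {A : IntermediateField K Ω // IsReachable m K Ω A} => A.1) ⟨A, h⟩

variable [Algebra ℂ K] [IsScalarTower ℂ K Ω]

theorem IsReachable.hasResolventTower [Algebra.IsAlgebraic K Ω] {A : IntermediateField K Ω}
    (h : IsReachable m K Ω A) : HasResolventTower m K A := by
  induction h with
  | bot =>
    refine ⟨inferInstance, 0, fun _ => ⊤, ⟨?_, by simp, rfl⟩, by simp⟩
    refine (eq_top_iff.2 ?_).symm
    rintro ⟨a, ha⟩ -
    obtain ⟨b, rfl⟩ := IntermediateField.mem_bot.1 ha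
    exact ⟨b, rfl⟩
  | step A Y x hA hY hYm hx ih =>
    have := ih.1
    have : FiniteDimensional K (IntermediateField.adjoin K {x}) :=
      IntermediateField.adjoin.finiteDimensional (Algebra.IsIntegral.isIntegral x)
    set A' := A ⊔ IntermediateField.adjoin K {x} with hA'
    have hAA' : A ≤ A' := le_sup_left
    have hxA' : x ∈ A' :=
      (le_sup_right : _ ≤ A') (IntermediateField.mem_adjoin_simple_self K x)
    let Y' : Finset A' := Y.attach.map
      ⟨fun y : {y // y ∈ Y} => ⟨y, hAA' (hY y y.2)⟩, fun a b h =>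
        Subtype.ext (congrArg (fun z : A' => (z : Ω)) h)⟩
    have hYY' : (A'.val.restrictScalars ℂ) '' (Y' : Set A') = Y := by
      ext y
      constructor
      · rintro ⟨z, hz, rfl⟩
        obtain ⟨w, -, rfl⟩ := Finset.mem_map.1 hz
        exact w.2
      · intro hy
        exact ⟨⟨y, hAA' (hY y hy)⟩, Finset.mem_map.2 ⟨⟨y, hy⟩, Finset.mem_attach _ _, rfl⟩, rfl⟩
    have hx' : IsAlgebraic (Algebra.adjoin ℂ (Y' : Set A')) (⟨x, hxA'⟩ : A') :=
      isAlgebraic_adjoin_of_image (A'.val.restrictScalars ℂ) (by rw [hYY']; exact hx)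
    refine ih.extend (IntermediateField.inclusion hAA') Y' (by simpa [Y'] using hYm) ?_ hx' ?_
    · intro y hy
      obtain ⟨z, -, rfl⟩ := Finset.mem_map.1 hy
      exact ⟨⟨z, hY z z.2⟩, rfl⟩
    · set T := ((IntermediateField.inclusion hAA').restrictScalars ℂ).fieldRange ⊔
        IntermediateField.adjoin ℂ {(⟨x, hxA'⟩ : A')}
      have hT1 : ∀ a (ha : a ∈ A), (⟨a, hAA' ha⟩ : A') ∈ T := fun a ha =>
        (le_sup_left : _ ≤ T) ⟨⟨a, ha⟩, rfl⟩
      have hT2 : (⟨x, hxA'⟩ : A') ∈ T :=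
        (le_sup_right : _ ≤ T) (IntermediateField.mem_adjoin_simple_self ℂ _)
      -- `T` contains `A` and hence `K`, so it can be viewed over `K`; its image in `Ω` contains `A`
      -- and `x`, therefore all of `A'`.
      let T' : IntermediateField K A' :=
        T.toSubfield.toIntermediateField fun b => hT1 (algebraMap K Ω b) (A.algebraMap_mem b)
      have hle : A' ≤ T'.map A'.val := by
        refine sup_le (fun a ha => ⟨_, hT1 a ha, rfl⟩) ?_
        rw [IntermediateField.adjoin_simple_le_iff]
        exact ⟨_, hT2, rfl⟩
      refine eq_top_iff.2 fun a _ => ?_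
      obtain ⟨b, hb, hba⟩ := hle a.2
      rw [← (Subtype.ext hba : b = a)]
      exact hb

/-- A finite set in the directed union lies in one reachable field, where a further step is
available. -/
theorem rdClosed_rdClosure : RDClosed m ((rdClosure m K Ω).restrictScalars ℂ) := by
  intro Y hY hYm x hx
  obtain ⟨A, hA, hYA⟩ := exists_isReachable_of_finset Y hY
  exact (hA.step _ Y x hYA hYm hx).le_rdClosure
    ((le_sup_right : _ ≤ A ⊔ _) (IntermediateField.mem_adjoin_simple_self K x))

end reachable

/-! ### Transcendence degree and finite sets of parameters -/

section transcendence

variable {k E : Type*} [Field k] [Field E] [Algebra k E]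

theorem exists_finset_isAlgebraic_adjoin {s : Set E} {x : E}
    (hx : IsIntegral (IntermediateField.adjoin k s) x) :
    ∃ Y : Finset E, (Y : Set E) ⊆ s ∧ IsAlgebraic (Algebra.adjoin k (Y : Set E)) x := by
  classical
  obtain ⟨p, hp, h0⟩ := hx
  choose Y hYs hY using fun i => IntermediateField.exists_finset_of_mem_adjoin (p.coeff i).2
  let Z : Finset E := p.support.biUnion Y
  refine ⟨Z, ?_, IntermediateField.isAlgebraic_adjoin_iff.1 (isAlgebraic_iff_isIntegral.2 ?_)⟩
  · intro y hy
    obtain ⟨i, -, hi⟩ := Finset.mem_biUnion.1 hy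
    exact hYs i hi
  · have hl : p.map (algebraMap _ E) ∈
        lifts (algebraMap (IntermediateField.adjoin k (Z : Set E)) E) := by
      rw [lifts_iff_coeff_lifts]
      intro i
      rw [coeff_map]
      by_cases hi : i ∈ p.support
      · exact ⟨⟨_, IntermediateField.adjoin.mono k _ _
          (Finset.coe_subset.2 (Finset.subset_biUnion_of_mem Y hi)) (hY i)⟩, rfl⟩
      · rw [notMem_support_iff.1 hi]; exact ⟨0, by simp⟩
    obtain ⟨q, hq⟩ := (mem_lifts _).1 hl
    refine ⟨q, ?_, ?_⟩
    · refine (Function.Injective.monic_map_iff (algebraMap _ E).injective).2 ?_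
      rw [hq]; exact hp.map _
    · rw [← eval_map, hq, eval_map, h0]

/-- An element algebraic over a field of transcendence degree at most `m` is algebraic over at
most `m` of its elements. -/
theorem exists_finset_of_isIntegral (F : IntermediateField k E) {x : E} (hx : IsIntegral F x) :
    ∃ Y : Finset E, (∀ y ∈ Y, y ∈ F) ∧ (Y.card : ℕ∞) ≤ Cardinal.toENat (Algebra.trdeg k F) ∧
      IsAlgebraic (Algebra.adjoin k (Y : Set E)) x := by
  obtain ⟨s, hs⟩ := exists_isTranscendenceBasis k F
  let t : Set E := F.val '' s
  let F₀ := IntermediateField.adjoin k t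
  have hF : ∀ a : F, IsAlgebraic F₀ (a : E) := by
    intro a
    have halg := hs.isAlgebraic
    rw [Subtype.range_coe] at halg
    have hmap : (Algebra.adjoin k s).map F.val = Algebra.adjoin k t := AlgHom.map_adjoin F.val s
    let f : Algebra.adjoin k s →ₐ[k] Algebra.adjoin k t :=
      (F.val.comp (Algebra.adjoin k s).val).codRestrict _ fun a => by
        rw [← hmap]; exact ⟨a, a.2, rfl⟩
    refine IntermediateField.isAlgebraic_adjoin_iff.2 ?_
    refine (halg.isAlgebraic a).ringHom_of_comp_eq f F.val ?_ rfl
    intro b c hbc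
    exact Subtype.ext (Subtype.ext (congrArg (fun z : Algebra.adjoin k t => (z : E)) hbc))
  have hxF₀ : IsIntegral F₀ x := by
    rw [← isAlgebraic_iff_isIntegral]
    -- Transitivity of algebraicity: an element transcendental over `F₀` remains so over the
    -- algebraic closure `N` of `F₀` in `E`, but `F` maps into `N` and `x` is integral over `F`.
    by_contra hn
    refine Transcendental.algebraicClosure (F := F₀) (E := E) hn ?_
    rw [isAlgebraic_iff_isIntegral]
    let N := algebraicClosure F₀ E
    let f : F →+* N :=
      (algebraMap F E).codRestrict N.toSubfield fun a =>
        mem_algebraicClosure_iff.2 (hF a)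
    obtain ⟨p, hp, h0⟩ := hx
    refine ⟨p.map f, hp.map f, ?_⟩
    rw [eval₂_map]
    exact h0
  obtain ⟨Y, hYt, hY⟩ := exists_finset_isAlgebraic_adjoin hxF₀
  refine ⟨Y, ?_, ?_, hY⟩
  · intro y hy
    obtain ⟨a, -, rfl⟩ := hYt hy
    exact a.2
  · have h1 : Cardinal.mk (Y : Set E) ≤ Algebra.trdeg k F := by
      rw [← hs.cardinalMk_eq_trdeg, ← Cardinal.mk_image_eq (f := F.val) F.val.injective]
      exact Cardinal.mk_le_mk_of_subset hYt
    have h2 := Cardinal.toENat.monotone' h1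
    have h3 : Cardinal.mk (Y : Set E) = Y.card := Cardinal.mk_coe_finset
    rw [h3] at h2
    simpa using h2

end transcendence

/-! ### Elements that specialize into a given field -/

section specialization

variable {E : Type v} [Field E] [Algebra ℂ E] {Ω : Type u} [Field Ω] [Algebra ℂ Ω]

/-- Specializations of `E` to `Ω` that are defined at finitely many suitable elements and map the
elements of `s` to `B` also map `x` to `B`. -/
def SpecializesInto (B : IntermediateField ℂ Ω) (s : Set E) (x : E) : Prop :=
  ∃ T : Finset E, x ∈ T ∧ ∀ S : Subalgebra ℂ E, (T : Set E) ⊆ S → ∀ ψ : S →ₐ[ℂ] Ω,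
    (∀ y : S, (y : E) ∈ s → ψ y ∈ B) → ∀ y : S, (y : E) = x → ψ y ∈ B

variable (B : IntermediateField ℂ Ω) (s : Set E)

theorem specializesInto_of_mem {x : E} (hx : x ∈ s) : SpecializesInto B s x :=
  ⟨{x}, by simp, fun _ _ _ h y hy => h y (hy ▸ hx)⟩

theorem SpecializesInto.op₂ {B : IntermediateField ℂ Ω} {s : Set E} {x y : E}
    (hx : SpecializesInto B s x) (hy : SpecializesInto B s y) {z : E}
    (h : ∀ (S : Subalgebra ℂ E) (ψ : S →ₐ[ℂ] Ω) (a b c : S), (a : E) = x → (b : E) = y →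
      (c : E) = z → ψ a ∈ B → ψ b ∈ B → ψ c ∈ B) : SpecializesInto B s z := by
  classical
  obtain ⟨T₁, hx₁, h₁⟩ := hx
  obtain ⟨T₂, hy₂, h₂⟩ := hy
  -- Including `z` forces the specialization to be defined there; for `z = x⁻¹` it makes `x` a unit
  -- of `S`.
  refine ⟨insert z (T₁ ∪ T₂), Finset.mem_insert_self _ _, fun S hS ψ hψ c hc => ?_⟩
  have hS₁ : (T₁ : Set E) ⊆ S := fun a ha =>
    hS (Finset.mem_insert_of_mem (Finset.mem_union_left _ ha))
  have hS₂ : (T₂ : Set E) ⊆ S := fun a ha =>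
    hS (Finset.mem_insert_of_mem (Finset.mem_union_right _ ha))
  exact h S ψ ⟨x, hS₁ hx₁⟩ ⟨y, hS₂ hy₂⟩ c rfl rfl hc (h₁ S hS₁ ψ hψ _ rfl)
    (h₂ S hS₂ ψ hψ _ rfl)

/-- The field of elements of `E` that specialize into `B`. -/
def specializationField : IntermediateField ℂ E where
  carrier := {x | SpecializesInto B s x}
  mul_mem' := fun {x y} hx hy => hx.op₂ hy fun S ψ a b c ha hb hc h1 h2 => by
    obtain rfl : c = a * b := Subtype.ext (by rw [hc, ← ha, ← hb]; rfl)
    rw [map_mul]; exact B.mul_mem h1 h2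
  add_mem' := fun {x y} hx hy => hx.op₂ hy fun S ψ a b c ha hb hc h1 h2 => by
    obtain rfl : c = a + b := Subtype.ext (by rw [hc, ← ha, ← hb]; rfl)
    rw [map_add]; exact B.add_mem h1 h2
  algebraMap_mem' := fun r => ⟨{algebraMap ℂ E r}, by simp, fun S _ ψ _ y hy => by
    obtain rfl : y = algebraMap ℂ S r := Subtype.ext hy
    rw [AlgHom.commutes]; exact B.algebraMap_mem r⟩
  inv_mem' := fun x hx => by
    by_cases h0 : x = 0
    · rw [h0, inv_zero, ← h0]; exact hx
    refine hx.op₂ hx fun S ψ a b c ha hb hc h1 h2 => ?_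
    have hac : a * c = 1 := Subtype.ext (by
      change (a : E) * c = 1
      rw [ha, hc, mul_inv_cancel₀ h0])
    have h3 := congrArg ψ hac
    rw [map_mul, map_one] at h3
    rw [eq_inv_of_mul_eq_one_right h3]
    exact B.inv_mem h1

variable {B s}

/-- An equation for `x` over `Y` specializes to one for `ψ x` over `ψ Y`, which consists of at most
`m` elements of `B`. Placing the inverse of the leading coefficient in the finite test set keeps the
specialized equation from vanishing. -/
theorem mem_specializationField_of_isAlgebraic {m : ℕ∞} (hB : RDClosed m B) (Y : Finset E)
    (hY : ∀ y ∈ Y, y ∈ specializationField B s) (hYm : (Y.card : ℕ∞) ≤ m) {x : E}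
    (hx : IsAlgebraic (Algebra.adjoin ℂ (Y : Set E)) x) : x ∈ specializationField B s := by
  classical
  obtain ⟨p, hp0, hp⟩ := hx
  choose! T hyT hT using hY
  have hc : (p.leadingCoeff : E) ≠ 0 := fun h =>
    hp0 (leadingCoeff_eq_zero.1 (Subtype.ext h))
  refine ⟨insert x (insert (p.leadingCoeff : E)⁻¹ (Y.biUnion T)), Finset.mem_insert_self _ _,
    fun S hS ψ hψ z hz => ?_⟩
  have hST : ∀ y ∈ Y, (T y : Set E) ⊆ S := fun y hy a ha =>
    hS (Finset.mem_insert_of_mem (Finset.mem_insert_of_mem (Finset.mem_biUnion.2 ⟨y, hy, ha⟩)))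
  have hYS : (Y : Set E) ⊆ S := fun y hy => hST y hy (hyT y hy)
  have hinv : (p.leadingCoeff : E)⁻¹ ∈ S :=
    hS (Finset.mem_insert_of_mem (Finset.mem_insert_self _ _))
  have halg := isAlgebraic_adjoin_image_of_leadingCoeff ψ hYS p (x := z) (by rw [hz]; exact hp)
    hc hinv
  let Y' : Finset Ω := Y.attach.image fun y : {y // y ∈ Y} => ψ ⟨y, hYS y.2⟩
  have hY' : ψ '' {y | (y : E) ∈ (Y : Set E)} = Y' := by
    ext a
    simp only [Y', Finset.coe_image, Set.mem_image]
    constructor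
    · rintro ⟨y, hy, rfl⟩; exact ⟨⟨y, hy⟩, Finset.mem_attach _ _, rfl⟩
    · rintro ⟨y, -, rfl⟩; exact ⟨_, y.2, rfl⟩
  rw [hY'] at halg
  refine hB Y' ?_ (le_trans ?_ hYm) _ halg
  · intro a ha
    obtain ⟨y, -, rfl⟩ := Finset.mem_image.1 ha
    exact hT y y.2 S (hST y y.2) ψ hψ _ rfl
  · have := Finset.card_image_le (s := Y.attach) (f := fun y : {y // y ∈ Y} => ψ ⟨y, hYS y.2⟩)
    rw [Finset.card_attach] at this
    exact_mod_cast this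

end specialization

section towers

variable {E : Type v} [Field E] [Algebra ℂ E] {Ω : Type u} [Field Ω] [Algebra ℂ Ω]
  {B : IntermediateField ℂ Ω} {s : Set E}

/-- The step is generated over `A` by a field `L` finite over some `F ≤ A` of transcendence degree
at most `m`, so each element of `L` is algebraic over at most `m` elements of `A`. Finiteness
appears as `relfinrank ≠ 0`, since 0 is the default value for infinite degree. -/
theorem le_specializationField_of_essentialDimension_le {m : ℕ∞} (hm : m ≠ ⊤) (hB : RDClosed m B)
    {A A' : IntermediateField ℂ E} (hA : A ≤ specializationField B s)
    (hfin : IntermediateField.relfinrank A A' ≠ 0) (hed : essentialDimension A A' ≤ m) :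
    A' ≤ specializationField B s := by
  -- The infimum of the empty set is `⊤`, so `m ≠ ⊤` guarantees that the essential dimension is
  -- attained by some `F` and `L`.
  have hne : {e : ℕ∞ | ∃ F L : IntermediateField ℂ E, F ≤ A ∧ F ≤ L ∧ A ⊔ L = A' ∧
      IntermediateField.relfinrank F L = IntermediateField.relfinrank A A' ∧
      e = Cardinal.toENat (Algebra.trdeg ℂ F)}.Nonempty := by
    by_contra h
    rw [Set.not_nonempty_iff_eq_empty] at h
    rw [essentialDimension, h, sInf_empty, top_le_iff] at hed
    exact hm hed
  obtain ⟨F, L, hFA, hFL, hAL, hrel, he⟩ := csInf_mem hne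
  change essentialDimension A A' = _ at he
  rw [← hAL]
  refine sup_le hA fun x hx => ?_
  rw [← hrel, IntermediateField.relfinrank_eq_finrank_of_le hFL] at hfin
  have : FiniteDimensional F (IntermediateField.extendScalars hFL) :=
    Module.finite_of_finrank_pos (Nat.pos_of_ne_zero hfin)
  have hxF : IsIntegral F x := by
    have h1 : IsIntegral F (⟨x, hx⟩ : IntermediateField.extendScalars hFL) :=
      Algebra.IsIntegral.isIntegral _
    exact h1.map (IntermediateField.extendScalars hFL).val
  obtain ⟨Y, hYF, hYc, hY⟩ := exists_finset_of_isIntegral F hxF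
  exact mem_specializationField_of_isAlgebraic hB Y (fun y hy => hA (hFA (hYF y hy)))
    ((hYc.trans he.ge).trans hed) hY

end towers

theorem IsResolventTower.specializationField_eq_top {K E : Type v} [Field K] [Algebra ℂ K]
    [Field E] [Algebra ℂ E] [Algebra K E] [IsScalarTower ℂ K E] [FiniteDimensional K E] {n : ℕ}
    {c : ℕ → IntermediateField ℂ E} (hc : IsResolventTower K E n c) {m : ℕ∞} (hm : m ≠ ⊤)
    (hed : ∀ j < n, essentialDimension (c j) (c (j + 1)) ≤ m) {Ω : Type u} [Field Ω] [Algebra ℂ Ω]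
    {B : IntermediateField ℂ Ω} (hB : RDClosed m B) {s : Set E}
    (hs : (IsScalarTower.toAlgHom ℂ K E).fieldRange ≤ specializationField B s) :
    specializationField B s = ⊤ := by
  -- Relative degrees multiply, so finiteness of `E / K` keeps every step of the tower away from the
  -- default degree 0.
  have h0 : IntermediateField.relfinrank (c 0) ⊤ ≠ 0 := by
    rw [IntermediateField.relfinrank_top_right, hc.bot]
    let R := (IsScalarTower.toAlgHom ℂ K E).fieldRange
    let f : K →+* R := (algebraMap K E).codRestrict R fun a => ⟨a, rfl⟩
    let _ : Algebra K R := f.toAlgebra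
    have : IsScalarTower K R E := IsScalarTower.of_algebraMap_eq fun _ => rfl
    have : FiniteDimensional R E := Module.Finite.of_restrictScalars_finite K R E
    exact Module.finrank_pos.ne'
  have hcj : ∀ j ≤ n, c 0 ≤ c j ∧ c j ≤ specializationField B s := by
    intro j
    induction j with
    | zero => exact fun _ => ⟨le_rfl, hc.bot ▸ hs⟩
    | succ j ih =>
      intro hj
      obtain ⟨h1, h2⟩ := ih (by omega)
      have h3 := hc.le_succ j hj
      refine ⟨h1.trans h3, le_specializationField_of_essentialDimension_le hm hB h2 ?_ (hed j hj)⟩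
      intro h4
      apply h0
      rw [← IntermediateField.relfinrank_mul_relfinrank (h1.trans h3) le_top,
        ← IntermediateField.relfinrank_mul_relfinrank h1 h3, h4, mul_zero, zero_mul]
  exact top_le_iff.1 (hc.top ▸ (hcj n le_rfl).2)

/-! ### Extending homomorphisms into algebraically closed fields -/

section extension

/-- By lying over, the kernel of `φ` is the contraction of a prime `Q` of `S`; then `S / Q` is
algebraic over the image of `A` and embeds into `Ω`. -/
theorem exists_ringHom_extension_of_isIntegral {A : Type u} {S : Type v} {Ω : Type w} [CommRing A]
    [CommRing S] [Algebra A S] [Algebra.IsIntegral A S]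
    (hinj : Function.Injective (algebraMap A S)) [Field Ω] [IsAlgClosed Ω] (φ : A →+* Ω) :
    ∃ ψ : S →+* Ω, ψ.comp (algebraMap A S) = φ := by
  obtain ⟨P, hPφ⟩ : ∃ P, P = RingHom.ker φ := ⟨_, rfl⟩
  have hP : P.IsPrime := hPφ ▸ RingHom.ker_isPrime φ
  obtain ⟨Q, -, hQ, hQP⟩ := Ideal.exists_ideal_over_prime_of_isIntegral (S := S) P ⊥ (by
    rw [← RingHom.ker_eq_comap_bot, (RingHom.injective_iff_ker_eq_bot _).1 hinj]
    exact bot_le)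
  have : Q.LiesOver P := ⟨hQP.symm⟩
  let φ' : A ⧸ P →+* Ω := Ideal.Quotient.lift P φ fun a ha => by rwa [hPφ] at ha
  have hφ' : Function.Injective φ' := by
    rw [injective_iff_map_eq_zero]
    intro a ha
    obtain ⟨a, rfl⟩ := Ideal.Quotient.mk_surjective a
    rw [Ideal.Quotient.eq_zero_iff_mem, hPφ]
    exact ha
  let _ : Algebra (A ⧸ P) Ω := φ'.toAlgebra
  have : FaithfulSMul (A ⧸ P) Ω := (faithfulSMul_iff_algebraMap_injective _ _).2 hφ'
  have : Algebra.IsIntegral (A ⧸ P) (S ⧸ Q) := inferInstance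
  have : IsDomain (A ⧸ P) := Ideal.Quotient.isDomain P
  have : IsDomain (S ⧸ Q) := Ideal.Quotient.isDomain Q
  have : Algebra.IsAlgebraic (A ⧸ P) (S ⧸ Q) := Algebra.IsIntegral.isAlgebraic
  have : FaithfulSMul (A ⧸ P) (S ⧸ Q) := by
    rw [faithfulSMul_iff_algebraMap_injective, injective_iff_map_eq_zero]
    intro a ha
    obtain ⟨a, rfl⟩ := Ideal.Quotient.mk_surjective a
    have h : algebraMap A S a ∈ Q := Ideal.Quotient.eq_zero_iff_mem.1 ha
    rw [Ideal.Quotient.eq_zero_iff_mem, ← hQP]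
    exact h
  have : Module.IsTorsionFree (A ⧸ P) (S ⧸ Q) := .trans_faithfulSMul (A ⧸ P) (S ⧸ Q) (S ⧸ Q)
  let ψ : S ⧸ Q →ₐ[A ⧸ P] Ω := IsAlgClosed.lift
  refine ⟨(ψ : S ⧸ Q →+* Ω).comp (Ideal.Quotient.mk Q), ?_⟩
  ext a
  exact ψ.commutes (Ideal.Quotient.mk P a)

/-- A homomorphism from a subring `A` of a field `E`, algebraic over a subring `R` of `A`, to an
algebraically closed field extends to any given finite subset of `E` unless it kills a certain
nonzero element of `R`. -/
theorem exists_ringHom_extension {R A E : Type*} [CommRing R] [IsDomain R] [CommRing A] [Field E]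
    [Algebra R A] [Algebra R E] [Algebra A E] [IsScalarTower R A E]
    (hR : Function.Injective (algebraMap R E)) (hA : Function.Injective (algebraMap A E))
    (T : Finset E) (hT : ∀ t ∈ T, IsAlgebraic R t) :
    ∃ g : R, g ≠ 0 ∧ ∀ {Ω : Type w} [Field Ω] [IsAlgClosed Ω] (φ : A →+* Ω),
      φ (algebraMap R A g) ≠ 0 → ∃ (S : Subalgebra A E) (ψ : S →+* Ω), (T : Set E) ⊆ S ∧
        ∀ a : A, ψ (algebraMap A S a) = φ a := by
  classical
  choose! r hr0 hr using fun t ht => (hT t ht).exists_integral_multiple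
  -- Each `g • t` is integral over `A`. So `φ` first extends to the integral closure `D`, then to
  -- `D` with `g` inverted, and the latter contains `t = (g • t) / g`.
  refine ⟨∏ t ∈ T, r t, Finset.prod_ne_zero_iff.2 hr0, fun {Ω} _ _ φ hφ => ?_⟩
  set g := ∏ t ∈ T, r t with hg
  have hgT : ∀ t ∈ T, IsIntegral A (g • t) := fun t ht => by
    rw [hg, ← Finset.prod_erase_mul _ _ ht, mul_smul]
    exact ((hr t ht).smul _).tower_top
  let D := integralClosure A E
  have hAD : Function.Injective (algebraMap A D) := fun a b h =>
    hA (congrArg (fun z : D => (z : E)) h)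
  obtain ⟨ψ, hψ⟩ := exists_ringHom_extension_of_isIntegral hAD φ
  let y : D := algebraMap A D (algebraMap R A g)
  have hyE : (y : E) = algebraMap R E g := (IsScalarTower.algebraMap_apply R A E g).symm
  have hyE0 : (y : E) ≠ 0 := by
    rw [hyE, Ne, map_eq_zero_iff _ hR]
    exact Finset.prod_ne_zero_iff.2 hr0
  have hψy : IsUnit (ψ y) := by
    rw [show ψ y = φ (algebraMap R A g) from RingHom.congr_fun hψ _]
    exact isUnit_iff_ne_zero.2 hφ
  let i : Localization.Away y →+* E :=
    IsLocalization.Away.lift (g := algebraMap D E) y (isUnit_iff_ne_zero.2 hyE0)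
  let ψ' : Localization.Away y →+* Ω := IsLocalization.Away.lift (g := ψ) y hψy
  have hi : ∀ d : D, i (algebraMap D _ d) = d := fun d => IsLocalization.Away.lift_eq y _ d
  have hψ' : ∀ d : D, ψ' (algebraMap D _ d) = ψ d := fun d => IsLocalization.Away.lift_eq y hψy d
  have hinj : Function.Injective i := by
    rw [injective_iff_map_eq_zero]
    intro a ha
    obtain ⟨⟨d, ⟨_, n, rfl⟩⟩, hd⟩ := IsLocalization.surj (Submonoid.powers y) a
    have h1 := congrArg i hd
    rw [map_mul, ha, zero_mul, hi] at h1
    have h2 : d = 0 := Subtype.ext h1.symm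
    rw [h2, map_zero] at hd
    exact ((IsLocalization.map_units _ (⟨_, n, rfl⟩ : Submonoid.powers y)).mul_left_eq_zero).1 hd
  let iA : Localization.Away y →ₐ[A] E :=
    { i with
      commutes' := fun a => by
        change i _ = _
        rw [IsScalarTower.algebraMap_apply A D (Localization.Away y)]
        exact hi _ }
  let e := AlgEquiv.ofInjective iA hinj
  refine ⟨iA.range, ψ'.comp (e.symm : iA.range →+* Localization.Away y), ?_, ?_⟩
  · intro t ht
    let d : D := ⟨g • t, hgT t ht⟩
    refine ⟨IsLocalization.mk' _ d (⟨y, 1, by simp⟩ : Submonoid.powers y), ?_⟩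
    have h1 := congrArg i (IsLocalization.mk'_spec (Localization.Away y) d
      (⟨y, 1, by simp⟩ : Submonoid.powers y))
    rw [map_mul, hi, hi] at h1
    have h2 : (d : E) = t * y := by rw [hyE, mul_comm, ← Algebra.smul_def]
    rw [h2] at h1
    exact mul_right_cancel₀ hyE0 h1
  · intro a
    change ψ' (e.symm (algebraMap A iA.range a)) = _
    rw [e.symm.commutes, IsScalarTower.algebraMap_apply A D (Localization.Away y), hψ', ← hψ]
    rfl

end extension

/-! ### The general polynomial and specialization of its tower -/

section generalPolynomial

/-- The monic polynomial `X ^ n + b₁ X ^ (n - 1) + ⋯ + bₙ`. -/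
noncomputable def monicOfCoeffs {R : Type*} [CommRing R] {n : ℕ} (b : Fin n → R) : R[X] :=
  X ^ n + ∑ i : Fin n, C (b i) * X ^ (n - 1 - (i : ℕ))

variable {R S : Type*} [CommRing R] [CommRing S] {n : ℕ}

theorem map_monicOfCoeffs (f : R →+* S) (b : Fin n → R) :
    (monicOfCoeffs b).map f = monicOfCoeffs (fun i => f (b i)) := by
  simp [monicOfCoeffs, Polynomial.map_sum]

theorem degree_sum_coeffs_lt (b : Fin n → R) :
    (∑ i : Fin n, C (b i) * X ^ (n - 1 - (i : ℕ))).degree < (n : WithBot ℕ) := by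
  rw [← mem_degreeLT]
  refine sum_mem fun i _ => mem_degreeLT.2 ?_
  refine (degree_C_mul_X_pow_le _ _).trans_lt ?_
  have := i.2
  exact_mod_cast (show n - 1 - (i : ℕ) < n by omega)

theorem monic_monicOfCoeffs (b : Fin n → R) : (monicOfCoeffs b).Monic :=
  monic_X_pow_add (degree_sum_coeffs_lt b)

theorem monicOfCoeffs_coeff {p : R[X]} (hp : p.Monic) (hn : p.natDegree = n) :
    monicOfCoeffs (fun i : Fin n => p.coeff (n - 1 - i)) = p := by
  conv_rhs => rw [hp.as_sum, hn]
  rw [monicOfCoeffs, ← Finset.sum_range_reflect, Finset.sum_range]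

theorem natDegree_monicOfCoeffs [Nontrivial R] (b : Fin n → R) :
    (monicOfCoeffs b).natDegree = n := by
  rw [monicOfCoeffs, natDegree_add_eq_left_of_degree_lt, natDegree_X_pow]
  rw [degree_X_pow]
  exact degree_sum_coeffs_lt b

theorem coeff_monicOfCoeffs (b : Fin n → R) (i : Fin n) :
    (monicOfCoeffs b).coeff (n - 1 - i) = b i := by
  have hi := i.2
  rw [monicOfCoeffs, coeff_add, coeff_X_pow, if_neg (by omega), zero_add, finsetSum_coeff,
    Finset.sum_eq_single i]
  · simp
  · intro j _ hj
    have hj' := j.2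
    have : (j : ℕ) ≠ i := fun h => hj (Fin.ext h)
    rw [coeff_C_mul_X_pow, if_neg (by omega)]
  · simp

end generalPolynomial

/-- The tower that computes `RD(n)` solves all polynomials of degree `n` outside a proper closed
subset. -/
theorem exists_forall_root_mem_of_aeval_ne_zero (n : ℕ) (hn : generalRD n ≠ ⊤) {Ω : Type u}
    [Field Ω] [Algebra ℂ Ω] [IsAlgClosed Ω] {B : IntermediateField ℂ Ω}
    (hB : RDClosed (generalRD n) B) :
    ∃ g : MvPolynomial (Fin n) ℂ, g ≠ 0 ∧ ∀ b : Fin n → Ω, (∀ i, b i ∈ B) →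
      MvPolynomial.aeval b g ≠ 0 → ∀ r, (monicOfCoeffs b).eval r = 0 → r ∈ B := by
  let R := MvPolynomial (Fin n) ℂ
  let K := GeneralField n
  have hne : {m : ℕ∞ | ∃ (E : Type) (_ : Field E) (_ : Algebra ℂ E) (_ : Algebra K E)
      (_ : IsScalarTower ℂ K E) (N : ℕ) (c : ℕ → IntermediateField ℂ E),
      FiniteDimensional K E ∧ IsResolventTower K E N c ∧
      (∀ j < N, essentialDimension (c j) (c (j + 1)) ≤ m) ∧
      ∃ φ : AdjoinRoot (generalPolynomial n) →ₐ[K] E, Function.Injective φ}.Nonempty := by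
    by_contra h
    rw [Set.not_nonempty_iff_eq_empty] at h
    apply hn
    rw [generalRD, resolventDegree, h, sInf_empty]
  obtain ⟨E, _, _, _, _, N, c, hfin, hc, hed, φ, hφ⟩ := csInf_mem hne
  change ∀ j < N, _ ≤ generalRD n at hed
  let _ : Algebra R E := ((algebraMap K E).comp (algebraMap R K)).toAlgebra
  have : IsScalarTower R K E := IsScalarTower.of_algebraMap_eq fun _ => rfl
  have : IsScalarTower ℂ R E := IsScalarTower.of_algebraMap_eq fun a => by
    rw [IsScalarTower.algebraMap_apply ℂ K E, IsScalarTower.algebraMap_apply ℂ R K]; rfl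
  have hRE : Function.Injective (algebraMap R E) :=
    (algebraMap K E).injective.comp (IsFractionRing.injective R K)
  let f₀ : R[X] := monicOfCoeffs fun i => MvPolynomial.X i
  have hf₀ : f₀.map (algebraMap R K) = generalPolynomial n := map_monicOfCoeffs _ _
  let z : E := φ (AdjoinRoot.root (generalPolynomial n))
  have hev : ∀ q : R[X], eval₂ (algebraMap R E) z q =
      φ (AdjoinRoot.mk (generalPolynomial n) (q.map (algebraMap R K))) := by
    intro q
    rw [← AdjoinRoot.aeval_eq, ← Polynomial.aeval_algHom_apply, aeval_def, eval₂_map]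
    rfl
  have hz : eval₂ (algebraMap R E) z f₀ = 0 := by
    rw [hev, hf₀, AdjoinRoot.mk_self, map_zero]
  -- Extending from `A` rather than from `R` prescribes the image of the general root `z`, so every
  -- root `r` is reached.
  let A := AdjoinRoot f₀
  let _ : Algebra A E := (AdjoinRoot.lift (algebraMap R E) z hz).toAlgebra
  have hAE : ∀ q : R[X], algebraMap A E (AdjoinRoot.mk f₀ q) = eval₂ (algebraMap R E) z q :=
    fun q => AdjoinRoot.lift_mk hz q
  have : IsScalarTower R A E := IsScalarTower.of_algebraMap_eq fun a =>
    (AdjoinRoot.lift_of hz).symm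
  have hA : Function.Injective (algebraMap A E) := by
    rw [injective_iff_map_eq_zero]
    intro a ha
    obtain ⟨q, rfl⟩ := AdjoinRoot.mk_surjective a
    rw [hAE, hev, map_eq_zero_iff φ hφ, AdjoinRoot.mk_eq_zero, ← hf₀] at ha
    rw [AdjoinRoot.mk_eq_zero]
    -- As `f₀` is monic, divisibility by it descends from `K[X]` to `R[X]`; hence `A` embeds into
    -- `E`.
    exact (Polynomial.map_dvd_map _ (IsFractionRing.injective R K)
      (monic_monicOfCoeffs _)).1 ha
  let s : Set E := Set.range fun i : Fin n => algebraMap R E (MvPolynomial.X i)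
  have hK : (IsScalarTower.toAlgHom ℂ K E).fieldRange ≤ specializationField B s := by
    rintro _ ⟨a, rfl⟩
    have hR : ∀ p : R, algebraMap R E p ∈ specializationField B s := by
      intro p
      induction p using MvPolynomial.induction_on with
      | C a =>
        have := (specializationField B s).algebraMap_mem a
        rwa [IsScalarTower.algebraMap_apply ℂ R E] at this
      | add p q hp hq => rw [map_add]; exact add_mem hp hq
      | mul_X p i hp => rw [map_mul]; exact mul_mem hp (specializesInto_of_mem _ _ ⟨i, rfl⟩)
    obtain ⟨p, q, -, rfl⟩ := IsFractionRing.div_surjective (A := R) a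
    change algebraMap K E _ ∈ _
    rw [map_div₀]
    exact div_mem (hR p) (hR q)
  have htop := hc.specializationField_eq_top hn hed hB hK
  obtain ⟨T, hzT, hT⟩ : SpecializesInto B s z := by
    have : z ∈ specializationField B s := htop ▸ IntermediateField.mem_top
    exact this
  have halg : ∀ t : E, IsAlgebraic R t := fun t =>
    (IsFractionRing.isAlgebraic_iff R K E).2 (Algebra.IsAlgebraic.isAlgebraic t)
  obtain ⟨g, hg0, hg⟩ := exists_ringHom_extension hRE hA T fun t _ => halg t
  refine ⟨g, hg0, fun b hb hgb r hr => ?_⟩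
  have hr' : eval₂ (MvPolynomial.aeval b : R →ₐ[ℂ] Ω) r f₀ = 0 := by
    rw [← eval_map, map_monicOfCoeffs]
    exact (congrArg (fun c => eval r (monicOfCoeffs c))
      (funext fun i => MvPolynomial.aeval_X b i)).trans hr
  let ρ : A →+* Ω := AdjoinRoot.lift (MvPolynomial.aeval b : R →ₐ[ℂ] Ω) r hr'
  have hρ : ∀ p : R, ρ (algebraMap R A p) = MvPolynomial.aeval b p := fun p =>
    AdjoinRoot.lift_of hr'
  obtain ⟨S, ψ, hTS, hψ⟩ := hg ρ (by rwa [hρ])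
  let S' : Subalgebra ℂ E :=
    { S with
      algebraMap_mem' := fun a => by
        rw [IsScalarTower.algebraMap_apply ℂ R E, IsScalarTower.algebraMap_apply R A E]
        exact S.algebraMap_mem _ }
  let ψ' : S' →ₐ[ℂ] Ω :=
    { (ψ : S →+* Ω) with
      commutes' := fun a => by
        have h1 : (algebraMap ℂ S' a : S) = algebraMap A S (algebraMap R A (algebraMap ℂ R a)) := by
          apply Subtype.ext
          change algebraMap ℂ E a = algebraMap A E _
          rw [← IsScalarTower.algebraMap_apply R A E, ← IsScalarTower.algebraMap_apply ℂ R E]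
        change ψ (algebraMap ℂ S' a : S) = _
        rw [h1, hψ, hρ]
        exact (MvPolynomial.aeval b : R →ₐ[ℂ] Ω).commutes a }
  have hz' : (z : E) = algebraMap A E (AdjoinRoot.root f₀) := (AdjoinRoot.lift_root hz).symm
  have hψz : ψ' ⟨z, hTS hzT⟩ = r := by
    have h1 : (⟨z, hTS hzT⟩ : S) = algebraMap A S (AdjoinRoot.root f₀) := Subtype.ext hz'
    change ψ (⟨z, hTS hzT⟩ : S) = r
    rw [h1, hψ]
    exact AdjoinRoot.lift_root hr'
  rw [← hψz]
  refine hT S' hTS ψ' ?_ _ rfl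
  rintro y ⟨i, hi⟩
  have h1 : (y : S) = algebraMap A S (algebraMap R A (MvPolynomial.X i)) :=
    Subtype.ext (hi.symm.trans (IsScalarTower.algebraMap_apply R A E _))
  change ψ (y : S) ∈ B
  rw [h1, hψ, hρ, MvPolynomial.aeval_X]
  exact hb i

/-! ### Tschirnhaus transformations -/

section tschirnhaus

variable {Ω : Type u} [Field Ω] {n : ℕ}

/-- The value at `T = a` of the universal polynomial `∑ tⱼ Tʲ` of degree less than `n`. -/
noncomputable def universalValue (n : ℕ) (a : Ω) : MvPolynomial (Fin n) Ω :=
  ∑ j : Fin n, MvPolynomial.C (a ^ (j : ℕ)) * MvPolynomial.X j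

theorem eval_universalValue (a : Ω) (t : Fin n → Ω) :
    MvPolynomial.eval t (universalValue n a) = ∑ j : Fin n, a ^ (j : ℕ) * t j := by
  simp [universalValue]

theorem exists_eval_universalValue_eq (w ρ : Fin n → Ω) (hw : Function.Injective w) :
    ∃ t : Fin n → Ω, ∀ i, MvPolynomial.eval t (universalValue n (w i)) = ρ i := by
  let p := Lagrange.interpolate Finset.univ w ρ
  have hdeg : p.degree < n := by
    have h := Lagrange.degree_interpolate_lt (s := Finset.univ) ρ hw.injOn
    rwa [Finset.card_univ, Fintype.card_fin] at h
  refine ⟨fun j => p.coeff j, fun i => ?_⟩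
  rw [eval_universalValue, ← Lagrange.eval_interpolate_at_node ρ hw.injOn (Finset.mem_univ i)]
  change _ = p.eval (w i)
  rw [eval_eq_sum_range' (n := n) ?_, Finset.sum_range]
  · exact Finset.sum_congr rfl fun j _ => mul_comm _ _
  · by_cases hp : p = 0
    · rw [hp, natDegree_zero]; exact i.pos
    · exact (natDegree_lt_iff_degree_lt hp).2 hdeg

theorem exists_eq_prod_X_sub_C [IsAlgClosed Ω] {p : Polynomial Ω} (hp : p.Monic)
    (hn : p.natDegree = n) :
    ∃ ρ : Fin n → Ω, p = ∏ i, (X - C (ρ i)) := by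
  have hs := IsAlgClosed.splits p
  have hcard : p.roots.toList.length = n := by
    rw [Multiset.length_toList, ← hn, hs.natDegree_eq_card_roots]
  subst hcard
  refine ⟨fun i => p.roots.toList.get i, ?_⟩
  have h1 := hs.eq_prod_roots_of_monic hp
  conv_lhs => rw [h1, ← Multiset.coe_toList p.roots]
  rw [Multiset.map_coe, Multiset.prod_coe, ← List.prod_ofFn]
  congr 1
  conv_lhs => rw [← List.ofFn_get p.roots.toList]
  rw [List.map_ofFn]
  rfl

variable [Algebra ℂ Ω]

/-- A generic Tschirnhaus transformation with coefficients in `ℂ` avoids a given proper closed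
subset of the space of monic polynomials. -/
theorem exists_generic_transformation [IsAlgClosed Ω] {g : MvPolynomial (Fin n) ℂ} (hg : g ≠ 0)
    {w : Fin n → Ω} (hw : Function.Injective w) :
    ∃ q : ℂ[X], Function.Injective (fun i => aeval (w i) q) ∧
      MvPolynomial.aeval (fun i : Fin n => (∏ l, (X - C (aeval (w l) q))).coeff (n - 1 - i)) g
        ≠ 0 := by
  classical
  let H : (MvPolynomial (Fin n) Ω)[X] := ∏ l, (X - C (universalValue n (w l)))
  let G₁ : MvPolynomial (Fin n) Ω := MvPolynomial.aeval (fun i : Fin n => H.coeff (n - 1 - i)) g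
  let G₂ : MvPolynomial (Fin n) Ω := ∏ i, ∏ j ∈ Finset.univ.erase i,
    (universalValue n (w i) - universalValue n (w j))
  have hG₁ : ∀ t, MvPolynomial.eval t G₁ = MvPolynomial.aeval (fun i : Fin n =>
      (∏ l, (X - C (MvPolynomial.eval t (universalValue n (w l))))).coeff (n - 1 - i)) g := by
    intro t
    have hH : ∀ k, MvPolynomial.eval t (H.coeff k) =
        (∏ l, (X - C (MvPolynomial.eval t (universalValue n (w l))))).coeff k := by
      intro k
      rw [← coeff_map, Polynomial.map_prod]
      simp
    simp only [← hH]
    have h1 : ((MvPolynomial.aeval t : MvPolynomial (Fin n) Ω →ₐ[Ω] Ω).restrictScalars ℂ).comp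
        (MvPolynomial.aeval (fun i : Fin n => H.coeff (n - 1 - i))) =
        MvPolynomial.aeval (fun i : Fin n => MvPolynomial.eval t (H.coeff (n - 1 - i))) := by
      ext i
      simp [MvPolynomial.aeval_eq_eval]
    have h2 := DFunLike.congr_fun h1 g
    rw [← h2]
    simp [G₁, MvPolynomial.aeval_eq_eval]
  -- Choose a complex point where `g` does not vanish. Interpolation moves the distinct `w i` to the
  -- roots of the corresponding polynomial, and there `G₁` takes a nonzero value.
  have hne₁ : G₁ ≠ 0 := by
    obtain ⟨c, hc⟩ : ∃ c, MvPolynomial.eval c g ≠ 0 := by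
      by_contra! h
      exact hg (MvPolynomial.funext fun x => by rw [h x, map_zero])
    let c' : Fin n → Ω := fun i => algebraMap ℂ Ω (c i)
    have hdeg : (monicOfCoeffs c').natDegree = n := natDegree_monicOfCoeffs c'
    obtain ⟨ρ, hρ⟩ := exists_eq_prod_X_sub_C (monic_monicOfCoeffs c') hdeg
    obtain ⟨t, ht⟩ := exists_eval_universalValue_eq w ρ hw
    intro h0
    have h1 := hG₁ t
    rw [h0, map_zero] at h1
    simp only [ht, ← hρ, coeff_monicOfCoeffs] at h1
    have h2 : MvPolynomial.aeval c' g = algebraMap ℂ Ω (MvPolynomial.eval c g) := by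
      rw [← MvPolynomial.aeval_eq_eval]
      exact MvPolynomial.aeval_algebraMap_apply Ω c g
    rw [h2, eq_comm, map_eq_zero] at h1
    exact hc h1
  have hne₂ : G₂ ≠ 0 := by
    obtain ⟨t, ht⟩ := exists_eval_universalValue_eq w w hw
    refine Finset.prod_ne_zero_iff.2 fun i _ => Finset.prod_ne_zero_iff.2 fun j hj h0 => ?_
    have h1 := congrArg (MvPolynomial.eval t) h0
    rw [map_sub, map_zero, ht, ht, sub_eq_zero] at h1
    exact Finset.ne_of_mem_erase hj (hw h1).symm
  -- A nonzero polynomial over `Ω` cannot vanish on all points with coordinates in the infinite set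
  -- `ℂ`. Complex coefficients make the transformation commute with the Galois group over `B`.
  obtain ⟨t, ht, hGt⟩ : ∃ t ∈ Set.pi Set.univ (fun _ : Fin n => Set.range (algebraMap ℂ Ω)),
      MvPolynomial.eval t (G₁ * G₂) ≠ 0 := by
    by_contra! h
    refine mul_ne_zero hne₁ hne₂ (MvPolynomial.funext_set
      (fun _ => Set.range (algebraMap ℂ Ω))
      (fun _ => Set.infinite_range_of_injective (algebraMap ℂ Ω).injective) fun x hx => ?_)
    rw [h x hx, map_zero]
  choose τ hτ using fun i => ht i (Set.mem_univ i)
  have hq : ∀ a : Ω, aeval a (∑ j : Fin n, C (τ j) * X ^ (j : ℕ)) =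
      MvPolynomial.eval t (universalValue n a) := by
    intro a
    rw [eval_universalValue, map_sum]
    refine Finset.sum_congr rfl fun j _ => ?_
    rw [map_mul, aeval_C, hτ, map_pow, aeval_X, mul_comm]
  rw [map_mul] at hGt
  refine ⟨∑ j : Fin n, C (τ j) * X ^ (j : ℕ), ?_, ?_⟩
  · intro i j hij
    by_contra hne
    simp only [hq] at hij
    apply right_ne_zero_of_mul hGt
    rw [map_prod]
    refine Finset.prod_eq_zero (Finset.mem_univ i) ?_
    rw [map_prod]
    refine Finset.prod_eq_zero (Finset.mem_erase.2 ⟨Ne.symm hne, Finset.mem_univ j⟩) ?_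
    rw [map_sub, hij, sub_self]
  · simp only [hq]
    rw [← hG₁]
    exact left_ne_zero_of_mul hGt

/-- A field over which almost all polynomials of degree `n` split contains all elements of degree
at most `n`. -/
theorem mem_of_natDegree_minpoly_le [IsAlgClosed Ω] {B : IntermediateField ℂ Ω}
    [Algebra.IsAlgebraic B Ω] {g : MvPolynomial (Fin n) ℂ} (hg : g ≠ 0)
    (hB : ∀ b : Fin n → Ω, (∀ i, b i ∈ B) → MvPolynomial.aeval b g ≠ 0 →
      ∀ r, (monicOfCoeffs b).eval r = 0 → r ∈ B) {x : Ω} (hx : (minpoly B x).natDegree ≤ n) :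
    x ∈ B := by
  classical
  have : CharZero B := charZero_of_injective_algebraMap (algebraMap ℂ B).injective
  have : IsAlgClosure B Ω := ⟨inferInstance, inferInstance⟩
  have : Normal B Ω := IsAlgClosure.normal B Ω
  have : IsGalois B Ω := ⟨⟩
  have hfix : ∀ y : Ω, (∀ σ : Gal(Ω/B), σ y = y) → y ∈ B := fun y hy => by
    obtain ⟨b, rfl⟩ := (InfiniteGalois.mem_range_algebraMap_iff_fixed y).2 hy
    exact b.2
  have hxint : IsIntegral B x := Algebra.IsIntegral.isIntegral x
  let s : Set Ω := (minpoly B x).rootSet Ω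
  have hs : s.ncard ≤ n := by
    exact (ncard_rootSet_le _ _).trans hx
  -- The conjugates of `x` are padded by complex numbers to a Galois-stable set of exactly `n`
  -- distinct elements. This treats all degrees up to `n` at once.
  have hinf : (s ∪ Set.range (algebraMap ℂ Ω)).Infinite :=
    (Set.infinite_range_of_injective (algebraMap ℂ Ω).injective).mono Set.subset_union_right
  obtain ⟨W, hsW, hWt, hWn⟩ := hinf.exists_superset_ncard_eq Set.subset_union_left
    (Set.toFinite s) hs
  have hn0 : n ≠ 0 := by
    rintro rfl
    exact (minpoly.natDegree_pos hxint).ne' (Nat.le_zero.1 hx)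
  have hWfin : Finite W := Set.finite_of_ncard_ne_zero (by rw [hWn]; exact hn0)
  let e : Fin n ≃ W := (Finite.equivFinOfCardEq hWn).symm
  let w : Fin n → Ω := fun i => e i
  have hw : Function.Injective w := Subtype.val_injective.comp e.injective
  have hσW : ∀ (σ : Gal(Ω/B)) (i : Fin n), σ (w i) ∈ W := by
    intro σ i
    rcases hWt (e i).2 with h | ⟨a, ha⟩
    · refine hsW ?_
      rw [mem_rootSet] at h ⊢
      refine ⟨h.1, ?_⟩
      have := Polynomial.aeval_algHom_apply (σ : Ω →ₐ[B] Ω) (w i) (minpoly B x)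
      exact this.trans (by rw [h.2, map_zero])
    · have h1 : σ (w i) = w i := by
        change σ (e i : Ω) = e i
        rw [← ha]
        exact σ.commutes (algebraMap ℂ B a)
      rw [h1]; exact (e i).2
  have hperm : ∀ σ : Gal(Ω/B), ∃ π : Fin n ≃ Fin n, ∀ i, σ (w i) = w (π i) := by
    intro σ
    let f : Fin n → Fin n := fun i => e.symm ⟨σ (w i), hσW σ i⟩
    have hf : ∀ i, w (f i) = σ (w i) := fun i => by simp [f, w]
    have hinj : Function.Injective f := fun i j hij =>
      hw (σ.injective (by rw [← hf, ← hf, hij]))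
    exact ⟨Equiv.ofBijective f (Finite.injective_iff_bijective.1 hinj), fun i => (hf i).symm⟩
  obtain ⟨q, hqinj, hqg⟩ := exists_generic_transformation hg hw
  have hσq : ∀ (σ : Gal(Ω/B)) (a : Ω), σ (aeval a q) = aeval (σ a) q := fun σ a =>
    (Polynomial.aeval_algHom_apply ((σ : Ω →ₐ[B] Ω).restrictScalars ℂ) a q).symm
  let h : Polynomial Ω := ∏ l, (X - C (aeval (w l) q))
  have hmonic : h.Monic := monic_prod_of_monic _ _ fun l _ => monic_X_sub_C _
  have hdeg : h.natDegree = n := by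
    rw [natDegree_prod_of_monic _ _ fun l _ => monic_X_sub_C (aeval (w l) q)]
    simp
  have hcoeff : ∀ k, h.coeff k ∈ B := by
    intro k
    refine hfix _ fun σ => ?_
    have h1 : h.map (σ : Ω →+* Ω) = h := by
      obtain ⟨π, hπ⟩ := hperm σ
      simp only [h, Polynomial.map_prod, Polynomial.map_sub, map_X, map_C]
      refine Fintype.prod_equiv π _ _ fun i => ?_
      congr 2
      rw [← hπ]
      exact hσq σ _
    conv_rhs => rw [← h1, coeff_map]
    rfl
  have hh : monicOfCoeffs (fun i : Fin n => h.coeff (n - 1 - i)) = h :=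
    monicOfCoeffs_coeff hmonic hdeg
  have hroot : ∀ l, h.eval (aeval (w l) q) = 0 := fun l => by
    rw [eval_prod]
    exact Finset.prod_eq_zero (Finset.mem_univ l) (by rw [eval_sub, eval_X, eval_C, sub_self])
  have hmem : ∀ l, aeval (w l) q ∈ B := fun l =>
    hB (fun i => h.coeff (n - 1 - i)) (fun i => hcoeff (n - 1 - i)) hqg (aeval (w l) q)
      (by rw [hh]; exact hroot l)
  have hxs : x ∈ s := by
    rw [mem_rootSet]
    exact ⟨minpoly.ne_zero hxint, minpoly.aeval B x⟩
  obtain ⟨i, hi⟩ : ∃ i, w i = x := ⟨e.symm ⟨x, hsW hxs⟩, by simp [w]⟩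
  -- An automorphism over `B` fixes every `q (w l)`; as `q` is injective on the padded set, it fixes
  -- `x` too.
  refine hfix x fun σ => ?_
  obtain ⟨π, hπ⟩ := hperm σ
  have h1 : σ (aeval (w i) q) = aeval (w i) q := σ.commutes ⟨_, hmem i⟩
  rw [hσq, hπ] at h1
  rw [← hi, hπ, hqinj h1]

end tschirnhaus

/-- A root in `Ω` has degree at most `n` over `B`, hence lies in `B`. Lower degrees need no
comparison between resolvent degrees of different general polynomials. -/
theorem hasRootsUpTo_of_rdClosed {n : ℕ} (hn : generalRD n ≠ ⊤) {Ω : Type u} [Field Ω]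
    [Algebra ℂ Ω] [IsAlgClosed Ω] {B : IntermediateField ℂ Ω} [Algebra.IsAlgebraic B Ω]
    (hB : RDClosed (generalRD n) B) : HasRootsUpTo B n := by
  obtain ⟨g, hg, hgB⟩ := exists_forall_root_mem_of_aeval_ne_zero n hn hB
  intro p hp1 hpn
  have hp0 : p ≠ 0 := by rintro rfl; simp at hp1
  obtain ⟨x, hx⟩ := IsAlgClosed.exists_aeval_eq_zero Ω p
    (fun h => by have := natDegree_eq_zero_iff_degree_le_zero.2 h.le; omega)
  have hxB : x ∈ B := mem_of_natDegree_minpoly_le hg hgB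
    ((natDegree_le_of_dvd (minpoly.dvd B x hx) hp0).trans hpn)
  refine ⟨⟨x, hxB⟩, ?_⟩
  have h1 : algebraMap B Ω (p.eval ⟨x, hxB⟩) = 0 := by
    rw [← hx, ← aeval_algebraMap_apply_eq_algebraMap_eval]; rfl
  exact (map_eq_zero _).1 h1

/-! ### Rational points over fields of bounded resolvent degree -/

section points

theorem eval_smul_of_isHomogeneous {R σ : Type*} [CommRing R] [Fintype σ] {f : MvPolynomial σ R}
    {j : ℕ} (hf : f.IsHomogeneous j) (a : R) (y : σ → R) :
    MvPolynomial.eval (a • y) f = a ^ j * MvPolynomial.eval y f := by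
  rw [MvPolynomial.eval_eq', MvPolynomial.eval_eq', Finset.mul_sum]
  refine Finset.sum_congr rfl fun m hm => ?_
  have h : ∑ i, m i = j := by
    rw [← hf (MvPolynomial.mem_support_iff.1 hm), Finsupp.weight_apply, Finsupp.sum_fintype] <;>
      simp
  simp only [Pi.smul_apply, smul_eq_mul, mul_pow, Finset.prod_mul_distrib,
    Finset.prod_pow_eq_pow_sum, h]
  ring

variable {K : Type u} [Field K] {r d : ℕ} {ℓ : ℕ → ℕ} (V : HypersurfaceIntersection K r d ℓ)

theorem HypersurfaceIntersection.nonempty_points {L : Type v} [Field L] [Algebra K L]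
    {y : Fin (r + 1) → L} (hy : y ≠ 0) (h : ∀ j i, MvPolynomial.aeval y (V.form j i) = 0) :
    (V.points L).Nonempty := by
  refine ⟨Projectivization.mk L y hy, fun j i => ?_⟩
  obtain ⟨a, ha⟩ := Projectivization.exists_smul_eq_mk_rep L y hy
  have h1 := eval_smul_of_isHomogeneous ((V.isHomogeneous j i).map (algebraMap K L)) (a : L) y
  rw [MvPolynomial.eval_map, ← MvPolynomial.aeval_def, MvPolynomial.eval_map,
    ← MvPolynomial.aeval_def, h, mul_zero] at h1
  rw [← ha]
  exact h1

theorem HasCommonZeros.exists_zero {B : Type v} [Field B] [Algebra K B]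
    (h : HasCommonZeros B r d ℓ) :
    ∃ y : Fin (r + 1) → B, y ≠ 0 ∧ ∀ j i, MvPolynomial.aeval y (V.form j i) = 0 := by
  obtain ⟨y, hy, hf⟩ := h (Σ j : Set.Icc 1 d, Fin (ℓ j)) (fun x => x.1)
    (fun x => (V.form x.1 x.2).map (algebraMap K B)) (fun x => x.1.2)
    (fun x => (V.isHomogeneous x.1 x.2).map _) (fun j h1 h2 => by
      have hinj : Function.Injective
          (fun x : {x : Σ j : Set.Icc 1 d, Fin (ℓ j) // (x.1 : ℕ) = j} =>
            (Fin.cast (congrArg ℓ x.2) x.1.2 : Fin (ℓ j))) := by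
        rintro ⟨⟨⟨a, ha⟩, k⟩, hx⟩ ⟨⟨⟨b, hb⟩, k'⟩, hy⟩ hk
        change a = j at hx
        change b = j at hy
        subst hx
        subst hy
        obtain rfl : k = k' := hk
        rfl
      simpa using Nat.card_le_card_of_injective _ hinj)
  refine ⟨y, hy, fun j i => ?_⟩
  have := hf ⟨j, i⟩
  rwa [MvPolynomial.eval_map, ← MvPolynomial.aeval_def] at this

theorem exists_point_of_hasGeometricValue [Algebra ℂ K] {n : ℕ} (h : HasGeometricValue d ℓ n)
    (hr : n ≤ r) :
    ∃ (K' : Type u) (_ : Field K') (_ : Algebra K K'),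
      resolventDegree K K' ≤ generalRD d ∧ (V.points K').Nonempty := by
  classical
  let Ω := AlgebraicClosure K
  by_cases htop : generalRD d = ⊤
  · have hΩ : HasRootsUpTo Ω d := fun p h1 _ =>
      IsAlgClosed.exists_root p fun h => by
        have := natDegree_eq_zero_iff_degree_le_zero.2 h.le; omega
    obtain ⟨y, hy, hyV⟩ := (h.hasCommonZeros hr hΩ).exists_zero V
    exact ⟨Ω, _, _, htop ▸ le_top, V.nonempty_points hy hyV⟩
  · let B := rdClosure (generalRD d) K Ω
    have halg : Algebra.IsAlgebraic (B.restrictScalars ℂ) Ω :=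
      inferInstanceAs (Algebra.IsAlgebraic B Ω)
    have hB : HasRootsUpTo B d :=
      hasRootsUpTo_of_rdClosed htop (B := B.restrictScalars ℂ) rdClosed_rdClosure
    obtain ⟨y, hy, hyV⟩ := (h.hasCommonZeros hr hB).exists_zero V
    -- `B` need not be finite over `K`, but the finitely many coordinates of the zero lie in one
    -- reachable field.
    obtain ⟨A, hA, hyA⟩ := exists_isReachable_of_finset (m := generalRD d) (K := K)
      (Finset.univ.image fun i => (y i : Ω)) (by simp [B])
    let y' : Fin (r + 1) → A := fun i =>
      ⟨y i, hyA _ (Finset.mem_image_of_mem _ (Finset.mem_univ i))⟩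
    refine ⟨A, inferInstance, inferInstance, hA.hasResolventTower.resolventDegree_le,
      V.nonempty_points (y := y') (fun h0 => hy (funext fun i => ?_)) fun j i => ?_⟩
    · exact Subtype.ext (congrArg (fun z : A => (z : Ω)) (congrFun h0 i))
    · have hinj : Function.Injective A.val := A.val.injective
      apply hinj
      have h1 := congrArg B.val (hyV j i)
      rw [map_zero, ← AlgHom.comp_apply, MvPolynomial.comp_aeval] at h1
      rw [map_zero, ← AlgHom.comp_apply, MvPolynomial.comp_aeval]
      exact h1

end points

theorem mainTheorem3 (d : ℕ) (hd : 1 ≤ d) (ℓ : ℕ → ℕ) (hℓ : 1 ≤ ℓ d) :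
    minimalDimensionBound.{u} d ℓ ≤ geometricDimensionBound d ℓ ∧
      geometricDimensionBound d ℓ < ⊤ := by
  constructor
  -- The bound is proved for every value the recursion can take, so uniqueness of that value is not
  -- needed.
  · refine le_sInf ?_
    rintro _ ⟨n, hn, rfl⟩
    refine sInf_le ⟨by exact_mod_cast hn.one_le hℓ, fun r hr K _ _ _ V => ?_⟩
    exact exists_point_of_hasGeometricValue V hn (by exact_mod_cast hr)
  · obtain ⟨n, hn⟩ := exists_hasGeometricValue d hd ℓ
    have h : geometricDimensionBound d ℓ ≤ n := sInf_le ⟨n, hn, rfl⟩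
    exact h.trans_lt (ENat.natCast_lt_top n)
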